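/- Let $\mathcal Y=\mathbb R^n$ with an arbitrary norm $\|\cdot\|$ and let $\|\alpha\|_*=\sup_{\|y\|\le 1}|y^\top\alpha|$ be the dual norm. Let $\widehat y_1,\dots,\widehat y_N\in\mathcal Y$, let $\mathcal A\subseteq\mathbb R^n$ be a set of decisions, and let $\mathcal V\subseteq\mathbb R^N\times\mathbb R$ be a convex set such that $p$ is a probability vector ($p_i\ge 0$, $\sum_i p_i=1$) for every $(p,\delta)\in\mathcal V$. Put $\mathcal V_+=\{(p,\delta)\in\mathcal V:\delta\ge 0\}$ and $\widehat{\mathbb P}_p=\sum_{i=1}^N p_i\delta_{\widehat y_i}$, where $\delta_{\widehat y_i}$ is the unit point mass at $\widehat y_i$. For $q\in[1,\infty)$ and $\delta\in\mathbb R$ let $\mathbb B^q_\delta(\mathbb P)$ be the set of Borel probability measures $\mathbb Q$ on $\mathcal Y$ with $\inf_\pi\int\|y_1-y_2\|^q\,d\pi\le\delta$, the infimum being over all couplings $\pi$ of $\mathbb Q$ and $\mathbb P$ (so $\mathbb B^q_\delta(\mathbb P)=\emptyset$ if $\delta<0$). Let $h:[0,1]\to[0,1]$ be increasing and convex with $h(0)=0$,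 $h(1)=1$ and $\lim_{x\to1-}h(x)=1$, let $h'_-$ be its left derivative and $\|h'_-\|_r$ the $L^r$ norm of $h'_-$ on $(0,1]$ with respect to Lebesgue measure. For a random variable $Z$ with distribution function $F_Z$ put $\rho_h(Z)=\int_{\mathbb R}z\,dh(F_Z(z))$, and write $\rho^h_{\mathbb Q}[\ell(Y^\top\alpha)]$ for $\rho_h(\ell(Y^\top\alpha))$ with $Y\sim\mathbb Q$. Define $$\mathcal V^h_p=\Big\{\bar p\in\mathbb R^N:\ \bar p_i\ge 0,\ \sum_{i=1}^N\bar p_i=1,\ h\Big(\sum_{i\in J}p_i\Big)\le\sum_{i\in J}\bar p_i\ \ \forall J\subseteq\{1,\dots,N\}\Big\},$$ $$\mathcal V^h_+=\{(p,\delta,\bar p):(p,\delta)\in\mathcal V_+,\ \bar p\in\mathcal V^h_p\}\subseteq\mathbb R^{2N+1},\qquad \sigma^*(v\mid\mathcal V^h_+)=\sup_{x\in\mathcal V^h_+}v^\top x .$$ The union-ball problem of order $q$ is $$\inf_{\alpha\in\mathcal A}\ \sup\Big\{\rho^h_{\mathbb Q}[\ell(Y^\top\alpha)]\ :\ \mathbb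 Q\in\bigcup_{(p,\delta)\in\mathcal V}\mathbb B^q_\delta(\widehat{\mathbb P}_p)\Big\}.\qquad(\ast)$$ All optimal values are extended real numbers ($\sup\emptyset=-\infty$, $\inf\emptyset=+\infty$). We say that two problems over $\alpha\in\mathcal A$ are equivalent if their objectives agree at every $\alpha\in\mathcal A$ (so they have the same minimizers and the same value), and that a problem over $\alpha\in\mathcal A$ is solved by a program in $(\alpha,v)$ if the two values agree and, for every fixed $\alpha\in\mathcal A$, the infimum of the program over $v$ equals the objective of the problem at $\alpha$. (i) Let $q=1$, let $\ell:\mathbb R\to\mathbb R$ be convex and Lipschitz with least Lipschitz constant $\operatorname{Lip}(\ell)$, and assume $\|h'_-\|_\infty<\infty$. Then the integrals defining the risks in $(\ast)$ converge absolutely, $(\ast)$ is equivalent to $$\inf_{\alpha\in\mathcal A}\ \sup_{(p,\delta)\in\mathcal V_+}\ \rho^h_{\widehat{\mathbb P}_p}[\ell(Y^\top\alpha)]+\operatorname{Lip}(\ell)\,\|h'_-\|_\infty\,\delta\,\|\alpha\|_*,$$ and it is solved by the following program, which is convex if $\mathcal A$ is convex: $$\inf_{\alpha\in\mathcal A,\,v\in\mathbb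 R^{2N+1}}\ \sigma^*(v\mid\mathcal V_+^h)\quad\text{s.t. } v_i\ge 0,\ v_{N+1+i}\ge\ell(\widehat y_i^\top\alpha)\ (i=1,\dots,N),\ \ v_{N+1}\ge\operatorname{Lip}(\ell)\|h'_-\|_\infty\|\alpha\|_* .$$ (ii) Let $q\in(1,\infty)$, $\frac1q+\frac1{q^*}=1$, assume $\|h'_-\|_{q^*}<\infty$, and let $\ell$ be $C>0$ times one of the functions $x+b$, $-x+b$ ($b\in\mathbb R$), $|x-b_1|+b_2$ ($b_1,b_2\in\mathbb R$). Then the integrals defining the risks in $(\ast)$ converge absolutely, $(\ast)$ is equivalent to $$\inf_{\alpha\in\mathcal A}\ \sup_{(p,\delta)\in\mathcal V_+}\ \rho^h_{\widehat{\mathbb P}_p}[\ell(Y^\top\alpha)]+C\,\|h'_-\|_{q^*}\,\delta^{1/q}\,\|\alpha\|_*,$$ and it is solved by the following program, which is convex if $\mathcal A$ is convex: $$\inf_{\alpha\in\mathcal A,\,v\in\mathbb R^{2N+1}}\ \sigma^*(v\mid\mathcal V_+^h)+C_{h,q}\,v_{N+1}\Big\|\frac{\alpha}{v_{N+1}}\Big\|_*^{\frac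 q{q-1}}\quad\text{s.t. } v_i\ge 0\ (i=1,\dots,N+1),\ v_{N+1+i}\ge\ell(\widehat y_i^\top\alpha)\ (i=1,\dots,N),$$ where $C_{h,q}=\big(q^{\frac1{1-q}}-q^{\frac q{1-q}}\big)\big(C\|h'_-\|_{q^*}\big)^{\frac q{q-1}}$ and, for $v_{N+1}=0$, the second term of the objective is read as $0$ if $\alpha=0$ and $+\infty$ if $\alpha\neq0$ (and as contributing nothing, i.e. the objective is $-\infty$, if $\mathcal V_+=\emptyset$). -/

import Mathlib

open MeasureTheory ProbabilityTheory Set Filter Topology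
open scoped ENNReal

noncomputable section

/-- A distortion function `h : [0,1] → [0,1]`: increasing with `h 0 = 0` and `h 1 = 1`.
Only the values on `[0,1]` matter. -/
structure Distortion where
  toFun : ℝ → ℝ
  monotoneOn' : MonotoneOn toFun (Icc 0 1)
  map_zero' : toFun 0 = 0
  map_one' : toFun 1 = 1

instance : CoeFun Distortion (fun _ => ℝ → ℝ) := ⟨Distortion.toFun⟩

theorem Distortion.monotone_comp_cdf (h : Distortion) (ν : Measure ℝ) :
    Monotone (fun z => h (cdf ν z)) := fun _ _ hab =>
  h.monotoneOn' ⟨cdf_nonneg ν _, cdf_le_one ν _⟩ ⟨cdf_nonneg ν _, cdf_le_one ν _⟩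
    (monotone_cdf ν hab)

/-- The Lebesgue-Stieltjes measure `d h(F(z))`, with `F` the distribution function of `ν`. -/
def Distortion.distortedLaw (h : Distortion) (ν : Measure ℝ) : Measure ℝ :=
  (h.monotone_comp_cdf ν).stieltjesFunction.measure

/-- The distortion risk measure `ρ_h = ∫ z d h(F(z))` of a random variable with law `ν`. -/
def Distortion.risk (h : Distortion) (ν : Measure ℝ) : ℝ :=
  ∫ z, z ∂(h.distortedLaw ν)

/-- The left derivative of `h`. -/
def Distortion.leftDeriv (h : Distortion) (x : ℝ) : ℝ := derivWithin h (Iic x) x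

/-- The `L^r` norm on `(0,1]` of the left derivative of `h`, with values in `[0,∞]`. -/
def Distortion.leftDerivNorm (h : Distortion) (r : ℝ≥0∞) : ℝ≥0∞ :=
  eLpNorm h.leftDeriv r (volume.restrict (Ioc 0 1))

/-- The least Lipschitz constant of a function `ℓ : ℝ → ℝ`. -/
def lipConst (ℓ : ℝ → ℝ) : ℝ :=
  sInf {K : ℝ | 0 ≤ K ∧ ∀ x y, |ℓ x - ℓ y| ≤ K * |x - y|}

/-- `π` is a coupling of `μ` and `ν`. -/
def IsCoupling {E : Type*} [MeasurableSpace E] (μ ν : Measure E) (π : Measure (E × E)) : Prop :=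
  π.map Prod.fst = μ ∧ π.map Prod.snd = ν

/-- Optimal transport cost for the ground cost `D`. -/
def otCost {E : Type*} [MeasurableSpace E] (D : E → E → ℝ) (μ ν : Measure E) : ℝ≥0∞ :=
  ⨅ (π : Measure (E × E)) (_ : IsCoupling μ ν π), ∫⁻ z, ENNReal.ofReal (D z.1 z.2) ∂π

/-- Optimal transport ball of radius `δ` (empty if `δ < 0`). -/
def otBall {E : Type*} [MeasurableSpace E] (D : E → E → ℝ) (δ : ℝ) (P : Measure E) :
    Set (Measure E) :=
  {Q | IsProbabilityMeasure Q ∧ ((otCost D Q P : ℝ≥0∞) : EReal) ≤ (δ : EReal)}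

/-- The discrete distribution `∑ i, p i • δ_{y i}`. -/
def discreteLaw {E : Type*} [MeasurableSpace E] {N : ℕ} (y : Fin N → E) (p : Fin N → ℝ) :
    Measure E :=
  ∑ i, ENNReal.ofReal (p i) • Measure.dirac (y i)

/-- The union of the balls with center `∑ i, p i • δ_{y i}` and radius `δ`, `(p, δ) ∈ V`. -/
def unionBall {E : Type*} [MeasurableSpace E] {N : ℕ} (D : E → E → ℝ) (y : Fin N → E)
    (V : Set ((Fin N → ℝ) × ℝ)) : Set (Measure E) :=
  ⋃ x ∈ V, otBall D x.2 (discreteLaw y x.1)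

/-- `ρ_h[ℓ(Yᵀα)]` when `Y` has law `Q`; the linear form `y ↦ yᵀα` is identified with `α`. -/
def lossRisk {E : Type*} [NormedAddCommGroup E] [NormedSpace ℝ E] [MeasurableSpace E]
    (h : Distortion) (ℓ : ℝ → ℝ) (α : StrongDual ℝ E) (Q : Measure E) : ℝ :=
  h.risk (Q.map (fun y => ℓ (α y)))

/-- The inner worst-case value of the union-ball problem at the decision `α`. -/
def worstCase {E : Type*} [NormedAddCommGroup E] [NormedSpace ℝ E] [MeasurableSpace E] {N : ℕ}
    (D : E → E → ℝ) (y : Fin N → E) (V : Set ((Fin N → ℝ) × ℝ))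
    (h : Distortion) (ℓ : ℝ → ℝ) (α : StrongDual ℝ E) : EReal :=
  ⨆ Q ∈ unionBall D y V, ((lossRisk h ℓ α Q : ℝ) : EReal)

/-- `V₊`, the pairs in `V` with nonnegative radius. -/
def Vplus {N : ℕ} (V : Set ((Fin N → ℝ) × ℝ)) : Set ((Fin N → ℝ) × ℝ) :=
  {x | x ∈ V ∧ 0 ≤ x.2}

/-- The risk envelope `V_p^h` of the distortion `h` at the weights `p`. -/
def riskEnvelope {N : ℕ} (h : Distortion) (p : Fin N → ℝ) : Set (Fin N → ℝ) :=
  {pb | ∑ i, pb i = 1 ∧ (∀ i, 0 ≤ pb i) ∧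
    ∀ J : Finset (Fin N), h (∑ i ∈ J, p i) ≤ ∑ i ∈ J, pb i}

/-- `V₊^h`, the triples `(p, δ, pb)` with `(p, δ) ∈ V₊` and `pb` in the risk envelope at `p`. -/
def VplusH {N : ℕ} (h : Distortion) (V : Set ((Fin N → ℝ) × ℝ)) :
    Set ((Fin N → ℝ) × ℝ × (Fin N → ℝ)) :=
  {x | (x.1, x.2.1) ∈ Vplus V ∧ x.2.2 ∈ riskEnvelope h x.1}

/-- The support function of a set `S` of vectors in `ℝ^(2N+1)`, written as triples. -/
def supportFn {N : ℕ} (S : Set ((Fin N → ℝ) × ℝ × (Fin N → ℝ)))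
    (v : (Fin N → ℝ) × ℝ × (Fin N → ℝ)) : EReal :=
  ⨆ x ∈ S, ((∑ i, v.1 i * x.1 i + v.2.1 * x.2.1 + ∑ i, v.2.2 i * x.2.2 i : ℝ) : EReal)

/-- The perspective term `K * w * ‖a / w‖ ^ r` for `w > 0`, extended to `w = 0` by its lower
semicontinuous hull: `0` if `a = 0`, and `+∞` otherwise. -/
def perspTerm {F : Type*} [NormedAddCommGroup F] [NormedSpace ℝ F] (K r w : ℝ) (a : F) : EReal :=
  open Classical in
  if w = 0 then (if a = 0 then 0 else ⊤) else ((K * w * ‖w⁻¹ • a‖ ^ r : ℝ) : EReal)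

/-- The inner value of the robust problem at `α`, where the radius `δ` enters through the
coefficient `r δ` of the dual norm of `α`. -/
def robustValue {E : Type*} [NormedAddCommGroup E] [NormedSpace ℝ E] [MeasurableSpace E] {N : ℕ}
    (y : Fin N → E) (V : Set ((Fin N → ℝ) × ℝ)) (h : Distortion) (ℓ : ℝ → ℝ) (r : ℝ → ℝ)
    (α : StrongDual ℝ E) : EReal :=
  ⨆ x ∈ Vplus V, ((lossRisk h ℓ α (discreteLaw y x.1) + r x.2 * ‖α‖ : ℝ) : EReal)

/-- Feasible pairs `(α, v)`, `v = (v_1..v_N, v_{N+1}, v_{N+2}..v_{2N+1})`, of the program with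
constraints `α ∈ A`, `v_i ≥ 0` and `v_{i+N+1} ≥ ℓ(y_iᵀα)` for `i ≤ N`, and `v_{N+1} ≥ κ * ‖α‖`. -/
def feasibleSet {E : Type*} [NormedAddCommGroup E] [NormedSpace ℝ E] {N : ℕ}
    (A : Set (StrongDual ℝ E)) (y : Fin N → E) (ℓ : ℝ → ℝ) (κ : ℝ) :
    Set (StrongDual ℝ E × ((Fin N → ℝ) × ℝ × (Fin N → ℝ))) :=
  {z | z.1 ∈ A ∧ (∀ i, 0 ≤ z.2.1 i) ∧ κ * ‖z.1‖ ≤ z.2.2.1 ∧ ∀ i, ℓ (z.1 (y i)) ≤ z.2.2.2 i}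

/-- Minimizing `f` over `S` is a convex program: `S` is convex, and `f` is a convex extended-real
function on `S` (its epigraph is convex). -/
def IsConvexProgram {X : Type*} [AddCommGroup X] [Module ℝ X] (S : Set X) (f : X → EReal) : Prop :=
  Convex ℝ S ∧ Convex ℝ {z : X × ℝ | z.1 ∈ S ∧ f z.1 ≤ (z.2 : EReal)}

/-- Minimizing `f` and minimizing `g` over `A` are equivalent: same objective at every decision,
hence the same minimizers, and the same optimal value. -/
def EquivalentProblems {F : Type*} (A : Set F) (f g : F → EReal) : Prop :=
  (∀ α ∈ A, f α = g α) ∧ (⨅ α ∈ A, f α) = (⨅ α ∈ A, g α)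

/-- Minimizing `f` over `A` is solved by the convex program of minimizing `obj` over the pairs
`(α, v) ∈ S`: the optimal values agree, also after fixing any `α ∈ A`, and the program is convex
whenever the decision set `A` is. -/
def SolvedByConvexProgram {F W : Type*} [AddCommGroup F] [Module ℝ F] [AddCommGroup W]
    [Module ℝ W] (A : Set F) (f : F → EReal) (S : Set (F × W)) (obj : F × W → EReal) : Prop :=
  (∀ α ∈ A, f α = ⨅ v ∈ {v : W | (α, v) ∈ S}, obj (α, v)) ∧
  (⨅ α ∈ A, f α) = (⨅ z ∈ S, obj z) ∧
  (Convex ℝ A → IsConvexProgram S obj)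

/-- `ℓ` is `C` times one of `x + b`, `-x + b`, `|x - b₁| + b₂`. -/
def IsSpecialLoss (C : ℝ) (ℓ : ℝ → ℝ) : Prop :=
  (∃ b : ℝ, ∀ x, ℓ x = C * (x + b)) ∨ (∃ b : ℝ, ∀ x, ℓ x = C * (-x + b)) ∨
    ∃ b₁ b₂ : ℝ, ∀ x, ℓ x = C * (|x - b₁| + b₂)

end

/-! Write g for the left derivative of h. Since h is convex and continuous on [0,1], it is the
integral of g, so g is a nondecreasing probability density on (0,1). If U is uniform and Z is its
own quantile function evaluated at U, then ρ_h(Z) = E[g(U) Z]; for any other uniform U on the same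
space, E[g(U) Z] ≤ ρ_h(Z). The inequality is a bathtub argument
(`Distortion.le_setIntegral_density`): g(U) gives an event of probability b the least mass when the
event is {U ≤ b}. It is then lifted to means by stochastic order
(`Distortion.integral_mul_le_risk`). Such a U exists after enlarging the space (`exists_rank`).

Upper bound on a ball (`Distortion.lossRisk_le_of_coupling`): couple Q with the discrete center and
let U be the rank of the loss under Q. The risk under Q is an exact tilted mean, the risk at the
center dominates the tilted mean with the same U, and Hölder bounds the difference.

Lower bound (`Distortion.exists_mem_otBall_le_lossRisk`): move the atoms by t(U) along a unit-ball
vector at which α attains its norm. For q > 1 take t proportional to g^(q*-1), the equality case of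
Hölder; the special losses grow at full slope C from every point. For q = 1 spend the whole budget
on ranks above x and let x tend to 1; only the slope of the loss at infinity and the values of g
near 1 matter, and the bound is approached but need not be attained.

Program: at a discrete law, ρ_h is the maximum of a linear form over the risk envelope, and the
triples (p, δ, p̄) form a convex set because h is convex. With a radius term linear in δ, the robust
value is a support function, monotone in v, so the smallest feasible v is optimal. With a term c
δ^(1/q), this concave function is the infimum over w of the affine functions w δ + const(w), by
Young. The exchange of this infimum with the supremum over the triples comes from separating convex
sets in the plane (`exists_affine_majorant`); no compactness of V enters. -/

noncomputable section

/-! ### The left derivative of a distortion as a probability density -/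

/-- The uniform distribution on the unit interval. -/
def unifMeasure : Measure ℝ := volume.restrict (Ioo 0 1)

instance : IsProbabilityMeasure unifMeasure := ⟨by simp [unifMeasure]⟩

theorem ae_unifMeasure_mem : ∀ᵐ u ∂unifMeasure, u ∈ Ioo (0 : ℝ) 1 :=
  ae_restrict_mem measurableSet_Ioo

theorem restrict_Ioc_eq_unifMeasure : volume.restrict (Ioc (0 : ℝ) 1) = unifMeasure :=
  (Measure.restrict_congr_set Ioo_ae_eq_Ioc).symm

theorem unifMeasure_real_Iic {x : ℝ} (hx : x ∈ Icc (0 : ℝ) 1) : unifMeasure.real (Iic x) = x := by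
  rw [← restrict_Ioc_eq_unifMeasure, Measure.real, Measure.restrict_apply measurableSet_Iic]
  have : Iic x ∩ Ioc 0 1 = Ioc 0 x := by
    ext u; simp only [mem_inter_iff, mem_Iic, mem_Ioc]
    constructor
    · rintro ⟨h1, h2, h3⟩; exact ⟨h2, h1⟩
    · rintro ⟨h1, h2⟩; exact ⟨h2, h1, h2.trans hx.2⟩
  rw [this]; simp [hx.1]

namespace Distortion

variable (h : Distortion)

theorem nonneg {x : ℝ} (hx : x ∈ Icc (0 : ℝ) 1) : 0 ≤ h x := by
  rw [← h.map_zero']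
  exact h.monotoneOn' ⟨le_rfl, zero_le_one⟩ hx hx.1

variable {h}

theorem le_self (hconv : ConvexOn ℝ (Icc 0 1) h) {x : ℝ} (hx : x ∈ Icc (0 : ℝ) 1) : h x ≤ x := by
  have := hconv.2 (x := 0) (y := 1) ⟨le_rfl, zero_le_one⟩ ⟨zero_le_one, le_rfl⟩
    (sub_nonneg.2 hx.2) hx.1 (by ring)
  have h0 : h 0 = 0 := h.map_zero'
  have h1 : h 1 = 1 := h.map_one'
  simpa [h0, h1] using this

/-- Convexity gives continuity in the interior; at 0 the function is squeezed between 0 and the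
identity, and at 1 continuity is the assumption `hcont`. -/
theorem continuousOn (hconv : ConvexOn ℝ (Icc 0 1) h) (hcont : Tendsto h (𝓝[<] 1) (𝓝 1)) :
    ContinuousOn h (Icc 0 1) := by
  intro x hx
  have h0 : h 0 = 0 := h.map_zero'
  have h1 : h 1 = 1 := h.map_one'
  rcases eq_or_lt_of_le hx.1 with rfl | hx0
  · rw [ContinuousWithinAt, h0]
    refine tendsto_of_tendsto_of_tendsto_of_le_of_le' tendsto_const_nhds
      (tendsto_nhdsWithin_of_tendsto_nhds tendsto_id) ?_ ?_
    · filter_upwards [self_mem_nhdsWithin] with y hy using h.nonneg hy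
    · filter_upwards [self_mem_nhdsWithin] with y hy using le_self hconv hy
  rcases eq_or_lt_of_le hx.2 with rfl | hx1
  · have : ContinuousWithinAt h (Iio 1) 1 := by rwa [ContinuousWithinAt, h1]
    have := this.insert
    rw [Iio_insert] at this
    exact this.mono fun y hy => hy.2
  · have := hconv.continuousOn_interior x (by rw [interior_Icc]; exact ⟨hx0, hx1⟩)
    rw [interior_Icc] at this
    exact (this.continuousAt (Ioo_mem_nhds hx0 hx1)).continuousWithinAt

theorem leftDeriv_eq_Iio (x : ℝ) : h.leftDeriv x = derivWithin h (Iio x) x := by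
  by_cases hd : DifferentiableWithinAt ℝ h (Iio x) x
  · exact (hd.hasDerivWithinAt.Iic_of_Iio).derivWithin (uniqueDiffWithinAt_Iic x)
  · have : ¬ DifferentiableWithinAt ℝ h (Iic x) x := fun h' => hd (h'.mono Iio_subset_Iic_self)
    rw [leftDeriv, derivWithin_zero_of_not_differentiableWithinAt hd,
      derivWithin_zero_of_not_differentiableWithinAt this]

theorem hasDerivWithinAt_leftDeriv (hconv : ConvexOn ℝ (Icc 0 1) h) {x : ℝ}
    (hx : x ∈ Ioo (0 : ℝ) 1) : HasDerivWithinAt h (h.leftDeriv x) (Iio x) x := by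
  rw [leftDeriv_eq_Iio]
  exact hconv.hasDerivWithinAt_leftDeriv_of_mem_interior (by rwa [interior_Icc])

theorem leftDeriv_nonneg (hconv : ConvexOn ℝ (Icc 0 1) h) {x : ℝ}
    (hx : x ∈ Ioo (0 : ℝ) 1) : 0 ≤ h.leftDeriv x := by
  refine le_of_tendsto_of_tendsto tendsto_const_nhds
    ((hasDerivWithinAt_iff_tendsto_slope' (by simp)).1 (hasDerivWithinAt_leftDeriv hconv hx)) ?_
  filter_upwards [Ioo_mem_nhdsLT hx.1] with y hy
  have := h.monotoneOn' ⟨hy.1.le, hy.2.le.trans hx.2.le⟩ ⟨hx.1.le, hx.2.le⟩ hy.2.le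
  rw [slope_comm, slope_def_field]
  exact div_nonneg (sub_nonneg.2 this) (sub_nonneg.2 hy.2.le)

variable (h) in
/-- The left derivative of `h` on the open unit interval, extended by zero. -/
def density : ℝ → ℝ := (Ioo (0 : ℝ) 1).indicator h.leftDeriv

theorem density_nonneg (hconv : ConvexOn ℝ (Icc 0 1) h) (x : ℝ) : 0 ≤ h.density x :=
  indicator_nonneg (fun _ hx => leftDeriv_nonneg hconv hx) x

/-- The extension by zero is harmless on the left, since the left derivative is nonnegative, but
destroys monotonicity at 1; hence the restriction to `Iio 1`. -/
theorem monotoneOn_density (hconv : ConvexOn ℝ (Icc 0 1) h) : MonotoneOn h.density (Iio 1) := by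
  intro x hx y hy hxy
  by_cases h0 : 0 < x
  · have hx' : x ∈ Ioo (0 : ℝ) 1 := ⟨h0, hx⟩
    have hy' : y ∈ Ioo (0 : ℝ) 1 := ⟨h0.trans_le hxy, hy⟩
    rw [density, indicator_of_mem hx', indicator_of_mem hy', leftDeriv_eq_Iio, leftDeriv_eq_Iio]
    exact hconv.monotoneOn_leftDeriv (by rwa [interior_Icc]) (by rwa [interior_Icc]) hxy
  · have : h.density x = 0 := indicator_of_notMem (fun hx' => h0 hx'.1) _
    rw [this]
    exact density_nonneg hconv y

/-- The density increases up to 1 and vanishes from there on, so its superlevel sets at nonnegative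
levels are intervals. -/
theorem measurable_density (hconv : ConvexOn ℝ (Icc 0 1) h) : Measurable h.density := by
  refine measurable_of_Ioi fun a => ?_
  rcases lt_or_ge a 0 with ha | ha
  · have : h.density ⁻¹' Ioi a = univ :=
      eq_univ_of_forall fun x => ha.trans_le (density_nonneg hconv x)
    rw [this]; exact MeasurableSet.univ
  · refine OrdConnected.measurableSet ⟨fun x hx y hy z hz => ?_⟩
    have hy1 : y < 1 := by
      by_contra hy1
      have : h.density y = 0 := indicator_of_notMem (fun hy' => hy1 hy'.2) _
      rw [mem_preimage, this, mem_Ioi] at hy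
      exact absurd hy (not_lt.2 ha)
    exact (mem_Ioi.1 hx).trans_le
      (monotoneOn_density hconv (hz.1.trans_lt (hz.2.trans_lt hy1)) (hz.2.trans_lt hy1) hz.1)

/-- The fundamental theorem of calculus is applied in its form for right derivatives; reflection in
the origin turns the left derivative of `h` into one. -/
theorem hasDerivWithinAt_reflect (hconv : ConvexOn ℝ (Icc 0 1) h) {x : ℝ}
    (hx : x ∈ Ioo (-1 : ℝ) 0) :
    HasDerivWithinAt (fun t => -h (-t)) (h.density (-x)) (Ioi x) x := by
  have hx' : -x ∈ Ioo (0 : ℝ) 1 := ⟨by linarith [hx.2], by linarith [hx.1]⟩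
  have h1 := hasDerivWithinAt_leftDeriv hconv hx'
  have h2 : HasDerivWithinAt (fun t : ℝ => -t) (-1) (Ioi x) x := (hasDerivAt_neg x).hasDerivWithinAt
  have h3 := (h1.scomp x h2 (fun t ht => mem_Iio.2 (neg_lt_neg ht))).neg
  rw [density, indicator_of_mem hx']
  rw [show -((-1 : ℝ) • h.leftDeriv (-x)) = h.leftDeriv (-x) by simp] at h3
  exact h3

theorem continuousOn_reflect (hconv : ConvexOn ℝ (Icc 0 1) h)
    (hcont : Tendsto h (𝓝[<] 1) (𝓝 1)) : ContinuousOn (fun t => -h (-t)) (Icc (-1) 0) :=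
  ((continuousOn hconv hcont).comp continuous_neg.continuousOn
    (fun t ht => ⟨by linarith [ht.2], by linarith [ht.1]⟩)).neg

theorem intervalIntegrable_density (hconv : ConvexOn ℝ (Icc 0 1) h)
    (hcont : Tendsto h (𝓝[<] 1) (𝓝 1)) : IntervalIntegrable h.density volume 0 1 := by
  have : IntervalIntegrable (fun t => h.density (-t)) volume (-1) 0 := by
    rw [intervalIntegrable_iff_integrableOn_Ioc_of_le (by norm_num)]
    exact intervalIntegral.integrableOn_deriv_right_of_nonneg (continuousOn_reflect hconv hcont)
      (fun x hx => hasDerivWithinAt_reflect hconv hx) (fun x _ => density_nonneg hconv _)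
  have h2 := this.comp_sub_left 0
  simpa using h2.symm

theorem integrable_density (hconv : ConvexOn ℝ (Icc 0 1) h)
    (hcont : Tendsto h (𝓝[<] 1) (𝓝 1)) : Integrable h.density unifMeasure := by
  rw [← restrict_Ioc_eq_unifMeasure]
  exact (intervalIntegrable_iff_integrableOn_Ioc_of_le zero_le_one).1
    (intervalIntegrable_density hconv hcont)

theorem intervalIntegral_density (hconv : ConvexOn ℝ (Icc 0 1) h)
    (hcont : Tendsto h (𝓝[<] 1) (𝓝 1)) {x : ℝ} (hx : x ∈ Icc (0 : ℝ) 1) :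
    ∫ u in (0)..x, h.density u = h x := by
  have hint : IntervalIntegrable (fun t => h.density (-t)) volume (-x) 0 := by
    have := (intervalIntegrable_density hconv hcont).mono_set (c := 0) (d := x)
      (by rw [uIcc_of_le hx.1, uIcc_of_le zero_le_one]; exact Icc_subset_Icc_right hx.2)
    simpa using (this.comp_sub_left 0).symm
  have key := intervalIntegral.integral_eq_sub_of_hasDeriv_right_of_le (a := -x) (b := 0)
    (by linarith [hx.1])
    ((continuousOn_reflect hconv hcont).mono (Icc_subset_Icc_left (by linarith [hx.2])))
    (fun t ht => hasDerivWithinAt_reflect hconv ⟨by linarith [ht.1, hx.2], ht.2⟩) hint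
  have h0 : h 0 = 0 := h.map_zero'
  rw [intervalIntegral.integral_comp_neg] at key
  simpa [h0] using key

theorem setIntegral_density_Iic (hconv : ConvexOn ℝ (Icc 0 1) h)
    (hcont : Tendsto h (𝓝[<] 1) (𝓝 1)) {x : ℝ} (hx : x ∈ Icc (0 : ℝ) 1) :
    ∫ u in Iic x, h.density u ∂unifMeasure = h x := by
  rw [← intervalIntegral_density hconv hcont hx, intervalIntegral.integral_of_le hx.1,
    ← restrict_Ioc_eq_unifMeasure, Measure.restrict_restrict measurableSet_Iic]
  have : Iic x ∩ Ioc 0 1 = Ioc 0 x := by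
    ext u; simp only [mem_inter_iff, mem_Iic, mem_Ioc]
    constructor
    · rintro ⟨h1, h2, h3⟩; exact ⟨h2, h1⟩
    · rintro ⟨h1, h2⟩; exact ⟨h2, h1, h2.trans hx.2⟩
  rw [this]

theorem integral_density (hconv : ConvexOn ℝ (Icc 0 1) h)
    (hcont : Tendsto h (𝓝[<] 1) (𝓝 1)) : ∫ u, h.density u ∂unifMeasure = 1 := by
  have h1 : h 1 = 1 := h.map_one'
  have := setIntegral_density_Iic hconv hcont (x := 1) ⟨zero_le_one, le_rfl⟩
  rw [h1] at this
  rw [← this, Measure.restrict_eq_self_of_ae_mem]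
  filter_upwards [ae_unifMeasure_mem] with u hu using hu.2.le

theorem leftDerivNorm_eq (r : ℝ≥0∞) : h.leftDerivNorm r = eLpNorm h.density r unifMeasure := by
  rw [leftDerivNorm, restrict_Ioc_eq_unifMeasure]
  refine eLpNorm_congr_ae ?_
  filter_upwards [ae_unifMeasure_mem] with u hu
  exact (indicator_of_mem hu _).symm

section Rank

variable {Ω : Type*} [MeasurableSpace Ω] {P : Measure Ω} {U : Ω → ℝ}

theorem _root_.isProbabilityMeasure_of_map_eq_unif (hU : Measurable U)
    (hPU : P.map U = unifMeasure) : IsProbabilityMeasure P :=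
  ⟨by rw [← preimage_univ (f := U), ← Measure.map_apply hU MeasurableSet.univ, hPU, measure_univ]⟩

theorem integrable_density_comp (hconv : ConvexOn ℝ (Icc 0 1) h)
    (hcont : Tendsto h (𝓝[<] 1) (𝓝 1)) (hU : Measurable U) (hPU : P.map U = unifMeasure) :
    Integrable (fun ω => h.density (U ω)) P := by
  have := integrable_density hconv hcont
  rw [← hPU] at this
  exact this.comp_measurable hU

theorem integral_density_comp (hconv : ConvexOn ℝ (Icc 0 1) h)
    (hcont : Tendsto h (𝓝[<] 1) (𝓝 1)) (hU : Measurable U) (hPU : P.map U = unifMeasure) :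
    ∫ ω, h.density (U ω) ∂P = 1 := by
  rw [← integral_density hconv hcont, ← hPU, integral_map hU.aemeasurable]
  exact (measurable_density hconv).aestronglyMeasurable

/-- Among all events of probability `b`, the mean of the density is least on `U ≤ b`. -/
theorem le_setIntegral_density (hconv : ConvexOn ℝ (Icc 0 1) h)
    (hcont : Tendsto h (𝓝[<] 1) (𝓝 1)) (hU : Measurable U) (hPU : P.map U = unifMeasure)
    {B : Set Ω} (hB : MeasurableSet B) : h (P.real B) ≤ ∫ ω in B, h.density (U ω) ∂P := by
  have := isProbabilityMeasure_of_map_eq_unif hU hPU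
  set b := P.real B with hb
  have hint := integrable_density_comp hconv hcont hU hPU
  have hb1 : b ≤ 1 := measureReal_le_one
  have hb0 : 0 ≤ b := measureReal_nonneg
  have hh1 : h 1 = 1 := h.map_one'
  -- The case b = 1 is separate because the density is zero at 1 by extension and cannot serve as a
  -- threshold there.
  rcases eq_or_lt_of_le hb1 with hb1 | hb1
  · have hBae : ∀ᵐ ω ∂P, ω ∈ B := by
      refine (mem_ae_iff_prob_eq_one hB).2 ?_
      rw [← ENNReal.ofReal_one, ← hb1, hb, ofReal_measureReal]
    rw [hb1, hh1, Measure.restrict_eq_self_of_ae_mem hBae, integral_density_comp hconv hcont hU hPU]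
  set D : Set Ω := U ⁻¹' Iic b with hD
  have hDm : MeasurableSet D := hU measurableSet_Iic
  have hPD : P.real D = b := by
    rw [hD, ← map_measureReal_apply hU measurableSet_Iic, hPU, unifMeasure_real_Iic ⟨hb0, hb1.le⟩]
  have hDint : ∫ ω in D, h.density (U ω) ∂P = h b := by
    rw [← setIntegral_density_Iic hconv hcont ⟨hb0, hb1.le⟩, ← hPU,
      setIntegral_map measurableSet_Iic (measurable_density hconv).aestronglyMeasurable hU.aemeasurable]
  set c := h.density b
  have hU1 : ∀ᵐ ω ∂P, U ω ∈ Ioo (0 : ℝ) 1 := by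
    have := ae_unifMeasure_mem
    rw [← hPU] at this
    exact ae_of_ae_map hU.aemeasurable this
  have hcint : Integrable (fun ω => h.density (U ω) - c) P := hint.sub (integrable_const c)
  -- Subtracting `c` costs both sides the same, as `B` and `D` have equal probability; afterwards
  -- the integrand is nonpositive on `D` and nonnegative off `D`, almost surely.
  have hle : ∫ ω in D, (h.density (U ω) - c) ∂P ≤ ∫ ω in B, (h.density (U ω) - c) ∂P := by
    rw [← integral_indicator hDm, ← integral_indicator hB]
    refine integral_mono_ae (hcint.indicator hDm) (hcint.indicator hB) ?_
    filter_upwards [hU1] with ω hω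
    by_cases h1 : ω ∈ D
    · have : h.density (U ω) ≤ c := monotoneOn_density hconv hω.2 hb1 h1
      by_cases h2 : ω ∈ B <;> simp [h1, h2, this]
    · have : c ≤ h.density (U ω) := monotoneOn_density hconv hb1 hω.2 (not_le.1 h1).le
      by_cases h2 : ω ∈ B <;> simp [h1, h2, this]
  rw [integral_sub hint.integrableOn (integrable_const c), hDint,
    integral_sub hint.integrableOn (integrable_const c)] at hle
  simpa [hPD, ← hb] using hle

end Rank

end Distortion

/-! ### Quantile functions and ranks -/

/-- The quantile function of a law on the line, extended by zero outside the unit interval. -/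
def quantile (ν : Measure ℝ) : ℝ → ℝ :=
  (Ioo (0 : ℝ) 1).indicator fun u => sInf {z | u ≤ cdf ν z}

/-- Right continuity of the distribution function makes the infimum attained, which gives the Galois
connection on which all later uses of quantiles rest. -/
theorem quantile_le_iff (ν : Measure ℝ) {u z : ℝ} (hu : u ∈ Ioo (0 : ℝ) 1) :
    quantile ν u ≤ z ↔ u ≤ cdf ν z := by
  rw [quantile, indicator_of_mem hu]
  have hne : {z | u ≤ cdf ν z}.Nonempty :=
    ((tendsto_order.1 (tendsto_cdf_atTop ν)).1 u hu.2).exists.imp fun _ h => h.le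
  have hbdd : BddBelow {z | u ≤ cdf ν z} := by
    obtain ⟨a, ha⟩ := ((tendsto_order.1 (tendsto_cdf_atBot ν)).2 u hu.1).exists
    refine ⟨a, fun z hz => ?_⟩
    by_contra hza
    exact absurd (hz.trans (monotone_cdf ν (not_le.1 hza).le)) (not_le.2 ha)
  constructor
  · intro hq
    have ht : Tendsto (cdf ν) (𝓝[>] z) (𝓝 (cdf ν z)) :=
      ((cdf ν).right_continuous z).mono_left (nhdsWithin_mono _ Ioi_subset_Ici_self)
    refine ge_of_tendsto ht ?_
    filter_upwards [self_mem_nhdsWithin] with z' hz'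
    obtain ⟨s, hs, hsz⟩ := (csInf_lt_iff hbdd hne).1 (hq.trans_lt hz')
    exact le_trans hs (monotone_cdf ν hsz.le)
  · exact fun hz => csInf_le hbdd hz

theorem measurable_quantile (ν : Measure ℝ) : Measurable (quantile ν) := by
  refine measurable_of_Iic fun z => ?_
  have : quantile ν ⁻¹' Iic z =
      (Ioo 0 1 ∩ Iic (cdf ν z)) ∪ ((Ioo 0 1)ᶜ ∩ {_u | (0 : ℝ) ≤ z}) := by
    ext u
    by_cases hu : u ∈ Ioo (0 : ℝ) 1
    · simp only [mem_preimage, mem_Iic, quantile_le_iff ν hu, mem_union, mem_inter_iff, hu,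
        true_and, mem_compl_iff, not_true_eq_false, false_and, or_false]
    · have hq : quantile ν u = 0 := indicator_of_notMem hu _
      simp only [mem_preimage, mem_Iic, hq, mem_union, mem_inter_iff, hu, false_and,
        mem_compl_iff, not_false_eq_true, true_and, false_or, mem_ofPred_eq]
  rw [this]
  exact (measurableSet_Ioo.inter measurableSet_Iic).union
    (measurableSet_Ioo.compl.inter (MeasurableSet.const _))

theorem cdf_mem_Icc (ν : Measure ℝ) (z : ℝ) : cdf ν z ∈ Icc (0 : ℝ) 1 :=
  ⟨cdf_nonneg ν z, cdf_le_one ν z⟩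

theorem map_quantile (ν : Measure ℝ) [IsProbabilityMeasure ν] :
    unifMeasure.map (quantile ν) = ν := by
  have := Measure.isProbabilityMeasure_map (μ := unifMeasure) (measurable_quantile ν).aemeasurable
  refine Measure.ext_of_Iic _ _ fun z => ?_
  rw [Measure.map_apply (measurable_quantile ν) measurableSet_Iic, ← ofReal_cdf,
    ← unifMeasure_real_Iic (cdf_mem_Icc ν z), ofReal_measureReal]
  refine measure_congr ?_
  filter_upwards [ae_unifMeasure_mem] with u hu
  exact propext (quantile_le_iff ν hu)

/-- A law with smaller distribution function has larger mean. -/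
theorem integral_id_le_of_cdf_le {μ ν : Measure ℝ} [IsProbabilityMeasure μ]
    [IsProbabilityMeasure ν] (hμ : Integrable (fun z : ℝ => z) μ)
    (hν : Integrable (fun z : ℝ => z) ν) (hle : ∀ z, μ (Iic z) ≤ ν (Iic z)) :
    ∫ z, z ∂ν ≤ ∫ z, z ∂μ := by
  have eμ := map_quantile μ
  have eν := map_quantile ν
  have hiμ : Integrable (quantile μ) unifMeasure := by
    rw [← eμ] at hμ
    exact hμ.comp_measurable (measurable_quantile _)
  have hiν : Integrable (quantile ν) unifMeasure := by
    rw [← eν] at hν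
    exact hν.comp_measurable (measurable_quantile _)
  have e1 : ∫ z, z ∂μ = ∫ u, quantile μ u ∂unifMeasure := by
    conv_lhs => rw [← eμ]
    exact integral_map (measurable_quantile _).aemeasurable aestronglyMeasurable_id
  have e2 : ∫ z, z ∂ν = ∫ u, quantile ν u ∂unifMeasure := by
    conv_lhs => rw [← eν]
    exact integral_map (measurable_quantile _).aemeasurable aestronglyMeasurable_id
  rw [e1, e2]
  -- Both means are now integrals over the same uniform variable, so it suffices to compare the
  -- quantiles pointwise; their order is opposite to that of the distribution functions.
  refine integral_mono_ae hiν hiμ ?_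
  filter_upwards [ae_unifMeasure_mem] with u hu
  refine (quantile_le_iff ν hu).2 (((quantile_le_iff μ hu).1 le_rfl).trans ?_)
  rw [cdf_eq_real, cdf_eq_real]
  exact ENNReal.toReal_mono (measure_ne_top _ _) (hle _)

/-- Every random variable `Z` is, on an extension of the probability space, the quantile function
at a uniform random variable. -/
theorem exists_rank {Ω : Type*} [MeasurableSpace Ω] (P : Measure Ω) [IsProbabilityMeasure P]
    {Z : Ω → ℝ} (hZ : Measurable Z) :
    ∃ ρ : Measure (Ω × ℝ), ρ.map Prod.fst = P ∧ ρ.map Prod.snd = unifMeasure ∧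
      ∀ᵐ w ∂ρ, Z w.1 = quantile (P.map Z) w.2 := by
  have := Measure.isProbabilityMeasure_map (μ := P) hZ.aemeasurable
  set q := quantile (P.map Z) with hq
  have hqm : Measurable q := measurable_quantile _
  -- Given Z = z, the rank is drawn from the conditional law of a uniform u given q(u) = z. Then (Z,
  -- rank) has the joint law of (q(u), u), which carries over both the uniform marginal and the
  -- relation Z = q(rank). Ties at atoms of Z are thereby randomized.
  set κ : Kernel ℝ ℝ := condDistrib id q unifMeasure with hκ
  have hdis : P.map Z ⊗ₘ κ = unifMeasure.map fun u => (q u, u) := by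
    have := compProd_map_condDistrib (μ := unifMeasure) (mβ := inferInstance) (X := q)
      (Y := (id : ℝ → ℝ)) aemeasurable_id
    rwa [hq, map_quantile] at this
  set ρ := P ⊗ₘ κ.comap Z hZ
  have hmap : ρ.map (fun w => (Z w.1, w.2)) = unifMeasure.map fun u => (q u, u) := by
    rw [← hdis]
    have hm : Measurable fun w : Ω × ℝ => (Z w.1, w.2) := by fun_prop
    ext s hs
    rw [Measure.map_apply hm hs, Measure.compProd_apply (hm hs), Measure.compProd_apply hs,
      lintegral_map (Kernel.measurable_kernel_prodMk_left hs) hZ]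
    rfl
  refine ⟨ρ, Measure.fst_compProd P _, ?_, ?_⟩
  · have h2 := congrArg (Measure.map Prod.snd) hmap
    rw [Measure.map_map measurable_snd (by fun_prop), Measure.map_map measurable_snd
      (by fun_prop)] at h2
    simpa [Function.comp_def] using h2
  · have h2 : ∀ᵐ w ∂(unifMeasure.map fun u => (q u, u)), w.1 = q w.2 := by
      rw [ae_map_iff (by fun_prop) (measurableSet_eq_fun (by fun_prop) (by fun_prop))]
      exact Eventually.of_forall fun _ => rfl
    rw [← hmap] at h2
    exact ae_of_ae_map (by fun_prop) h2

/-! ### Distortion risk as a mean under a change of measure -/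

namespace Distortion

variable {h : Distortion}

/-- Continuity of `h` makes z ↦ h(F(z)) right continuous, so the right limit built into the
Stieltjes function changes nothing, and it makes the limit at −∞ equal to h(0) = 0. -/
theorem distortedLaw_Iic (hconv : ConvexOn ℝ (Icc 0 1) h) (hcont : Tendsto h (𝓝[<] 1) (𝓝 1))
    (ν : Measure ℝ) (z : ℝ) : h.distortedLaw ν (Iic z) = ENNReal.ofReal (h (cdf ν z)) := by
  have hc := continuousOn hconv hcont
  have h0 : h 0 = 0 := h.map_zero'
  have heq : ∀ x, (h.monotone_comp_cdf ν).stieltjesFunction x = h (cdf ν x) := by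
    intro x
    rw [Monotone.stieltjesFunction_eq]
    refine ContinuousWithinAt.rightLim_eq ?_
    exact ContinuousWithinAt.comp (f := cdf ν) (g := h) (hc _ (cdf_mem_Icc ν x))
      ((cdf ν).right_continuous x) fun y _ => cdf_mem_Icc ν y
  have hbot : Tendsto (h.monotone_comp_cdf ν).stieltjesFunction atBot (𝓝 0) := by
    have h1 : Tendsto (cdf ν) atBot (𝓝[Icc 0 1] 0) :=
      tendsto_nhdsWithin_iff.2 ⟨tendsto_cdf_atBot ν, Eventually.of_forall (cdf_mem_Icc ν)⟩
    have h2 := (hc 0 ⟨le_rfl, zero_le_one⟩).tendsto.comp h1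
    rw [h0] at h2
    exact h2.congr fun x => (heq x).symm
  rw [distortedLaw, StieltjesFunction.measure_Iic _ hbot, heq, sub_zero]

theorem isProbabilityMeasure_distortedLaw (hconv : ConvexOn ℝ (Icc 0 1) h)
    (hcont : Tendsto h (𝓝[<] 1) (𝓝 1)) (ν : Measure ℝ) :
    IsProbabilityMeasure (h.distortedLaw ν) := by
  have h1 : h 1 = 1 := h.map_one'
  refine ⟨tendsto_nhds_unique (tendsto_measure_Iic_atTop (h.distortedLaw ν)) ?_⟩
  simp_rw [distortedLaw_Iic hconv hcont]
  have h3 : Tendsto (cdf ν) atTop (𝓝[Icc 0 1] 1) :=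
    tendsto_nhdsWithin_iff.2 ⟨tendsto_cdf_atTop ν, Eventually.of_forall (cdf_mem_Icc ν)⟩
  have h2 := (continuousOn hconv hcont 1 ⟨zero_le_one, le_rfl⟩).tendsto.comp h3
  rw [h1] at h2
  simpa using ENNReal.tendsto_ofReal h2

variable {Ω : Type*} [MeasurableSpace Ω] {P : Measure Ω} {U : Ω → ℝ}

variable (h P U) in
/-- The change of measure with the density `h'(U)`. -/
def tilt : Measure Ω := P.withDensity fun ω => ENNReal.ofReal (h.density (U ω))

theorem tilt_apply (hconv : ConvexOn ℝ (Icc 0 1) h) (hcont : Tendsto h (𝓝[<] 1) (𝓝 1))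
    (hU : Measurable U) (hPU : P.map U = unifMeasure) {B : Set Ω} (hB : MeasurableSet B) :
    h.tilt P U B = ENNReal.ofReal (∫ ω in B, h.density (U ω) ∂P) := by
  rw [tilt, withDensity_apply _ hB, ofReal_integral_eq_lintegral_ofReal
    (integrable_density_comp hconv hcont hU hPU).integrableOn
    (Eventually.of_forall fun ω => density_nonneg hconv _)]

theorem isProbabilityMeasure_tilt (hconv : ConvexOn ℝ (Icc 0 1) h)
    (hcont : Tendsto h (𝓝[<] 1) (𝓝 1)) (hU : Measurable U) (hPU : P.map U = unifMeasure) :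
    IsProbabilityMeasure (h.tilt P U) := by
  refine ⟨?_⟩
  rw [tilt_apply hconv hcont hU hPU MeasurableSet.univ, Measure.restrict_univ,
    integral_density_comp hconv hcont hU hPU, ENNReal.ofReal_one]

theorem integrable_tilt_iff (hconv : ConvexOn ℝ (Icc 0 1) h) (hU : Measurable U) {X : Ω → ℝ} :
    Integrable X (h.tilt P U) ↔ Integrable (fun ω => h.density (U ω) * X ω) P := by
  have hm : Measurable fun ω => ENNReal.ofReal (h.density (U ω)) :=
    ((measurable_density hconv).comp hU).ennreal_ofReal
  rw [tilt, integrable_withDensity_iff_integrable_smul' hm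
    (Eventually.of_forall fun ω => ENNReal.ofReal_lt_top)]
  simp only [smul_eq_mul, ENNReal.toReal_ofReal (density_nonneg hconv _)]

theorem integral_tilt (hconv : ConvexOn ℝ (Icc 0 1) h) (hU : Measurable U) (X : Ω → ℝ) :
    ∫ ω, X ω ∂(h.tilt P U) = ∫ ω, h.density (U ω) * X ω ∂P := by
  have hm : Measurable fun ω => ENNReal.ofReal (h.density (U ω)) :=
    ((measurable_density hconv).comp hU).ennreal_ofReal
  rw [tilt, integral_withDensity_eq_integral_toReal_smul hm
    (Eventually.of_forall fun ω => ENNReal.ofReal_lt_top)]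
  simp only [smul_eq_mul, ENNReal.toReal_ofReal (density_nonneg hconv _)]

theorem tilt_absolutelyContinuous : h.tilt P U ≪ P := withDensity_absolutelyContinuous _ _

/-- When X is the quantile function at U, the events X ≤ z and U ≤ F(z) agree almost surely, and the
tilted mass of the latter is the integral of the density up to F(z). -/
theorem map_tilt_of_ae_eq_quantile (hconv : ConvexOn ℝ (Icc 0 1) h)
    (hcont : Tendsto h (𝓝[<] 1) (𝓝 1)) (hU : Measurable U) (hPU : P.map U = unifMeasure)
    {X : Ω → ℝ} (hX : Measurable X) {ν : Measure ℝ} (hXU : ∀ᵐ ω ∂P, X ω = quantile ν (U ω)) :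
    (h.tilt P U).map X = h.distortedLaw ν := by
  have := isProbabilityMeasure_tilt hconv hcont hU hPU
  have := Measure.isProbabilityMeasure_map (μ := h.tilt P U) hX.aemeasurable
  have := isProbabilityMeasure_distortedLaw hconv hcont ν
  refine Measure.ext_of_Iic _ _ fun z => ?_
  rw [Measure.map_apply hX measurableSet_Iic, distortedLaw_Iic hconv hcont]
  have hU1 : ∀ᵐ ω ∂P, U ω ∈ Ioo (0 : ℝ) 1 :=
    ae_of_ae_map hU.aemeasurable (by rw [hPU]; exact ae_unifMeasure_mem)
  have hae : X ⁻¹' Iic z =ᵐ[h.tilt P U] U ⁻¹' Iic (cdf ν z) := by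
    filter_upwards [tilt_absolutelyContinuous.ae_le hXU, tilt_absolutelyContinuous.ae_le hU1]
      with ω h1 h2
    refine propext ?_
    change X ω ≤ z ↔ U ω ≤ cdf ν z
    rw [h1, quantile_le_iff ν h2]
  rw [measure_congr hae, tilt_apply hconv hcont hU hPU (hU measurableSet_Iic),
    ← setIntegral_map measurableSet_Iic (measurable_density hconv).aestronglyMeasurable
      hU.aemeasurable, hPU, setIntegral_density_Iic hconv hcont (cdf_mem_Icc ν z)]

/-- Here U is any uniform variable, in no prescribed relation to X; the bathtub inequality is
applied to the event X ≤ z. -/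
theorem le_map_tilt_Iic (hconv : ConvexOn ℝ (Icc 0 1) h)
    (hcont : Tendsto h (𝓝[<] 1) (𝓝 1)) (hU : Measurable U) (hPU : P.map U = unifMeasure)
    {X : Ω → ℝ} (hX : Measurable X) (z : ℝ) :
    h.distortedLaw (P.map X) (Iic z) ≤ (h.tilt P U).map X (Iic z) := by
  have := isProbabilityMeasure_of_map_eq_unif hU hPU
  have := Measure.isProbabilityMeasure_map (μ := P) hX.aemeasurable
  rw [Measure.map_apply hX measurableSet_Iic, distortedLaw_Iic hconv hcont,
    tilt_apply hconv hcont hU hPU (hX measurableSet_Iic), cdf_eq_real,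
    map_measureReal_apply hX measurableSet_Iic]
  exact ENNReal.ofReal_le_ofReal (le_setIntegral_density hconv hcont hU hPU (hX measurableSet_Iic))

/-- The distortion risk dominates the mean after every change of measure with density `h'(U)`. -/
theorem integral_mul_le_risk (hconv : ConvexOn ℝ (Icc 0 1) h)
    (hcont : Tendsto h (𝓝[<] 1) (𝓝 1)) (hU : Measurable U) (hPU : P.map U = unifMeasure)
    {X : Ω → ℝ} (hX : Measurable X) (hXU : Integrable (fun ω => h.density (U ω) * X ω) P)
    (hXi : Integrable (fun z : ℝ => z) (h.distortedLaw (P.map X))) :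
    ∫ ω, h.density (U ω) * X ω ∂P ≤ h.risk (P.map X) := by
  have := isProbabilityMeasure_tilt hconv hcont hU hPU
  have := Measure.isProbabilityMeasure_map (μ := h.tilt P U) hX.aemeasurable
  have := isProbabilityMeasure_distortedLaw hconv hcont (P.map X)
  rw [← integral_tilt hconv hU, risk, ← integral_map (φ := X) (f := fun z => z) hX.aemeasurable
    aestronglyMeasurable_id]
  refine integral_id_le_of_cdf_le hXi ?_ (le_map_tilt_Iic hconv hcont hU hPU hX)
  exact (integrable_map_measure aestronglyMeasurable_id hX.aemeasurable).2
    ((integrable_tilt_iff hconv hU).2 hXU)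

theorem integrable_distortedLaw_iff (hconv : ConvexOn ℝ (Icc 0 1) h)
    (hcont : Tendsto h (𝓝[<] 1) (𝓝 1)) (hU : Measurable U) (hPU : P.map U = unifMeasure)
    {X : Ω → ℝ} (hX : Measurable X) {ν : Measure ℝ} (hXU : ∀ᵐ ω ∂P, X ω = quantile ν (U ω)) :
    Integrable (fun z : ℝ => z) (h.distortedLaw ν) ↔
      Integrable (fun ω => h.density (U ω) * X ω) P := by
  rw [← map_tilt_of_ae_eq_quantile hconv hcont hU hPU hX hXU, ← integrable_tilt_iff hconv hU]
  exact integrable_map_measure aestronglyMeasurable_id hX.aemeasurable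

theorem risk_eq_integral (hconv : ConvexOn ℝ (Icc 0 1) h)
    (hcont : Tendsto h (𝓝[<] 1) (𝓝 1)) (hU : Measurable U) (hPU : P.map U = unifMeasure)
    {X : Ω → ℝ} (hX : Measurable X) {ν : Measure ℝ} (hXU : ∀ᵐ ω ∂P, X ω = quantile ν (U ω)) :
    h.risk ν = ∫ ω, h.density (U ω) * X ω ∂P := by
  rw [risk, ← map_tilt_of_ae_eq_quantile hconv hcont hU hPU hX hXU, ← integral_tilt hconv hU]
  exact integral_map hX.aemeasurable aestronglyMeasurable_id

end Distortion

/-! ### Discrete laws, Lipschitz losses and transport balls -/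

section DiscreteLaw

variable {E F : Type*} [MeasurableSpace E] [MeasurableSpace F] {N : ℕ}

theorem map_discreteLaw (y : Fin N → E) (p : Fin N → ℝ) {f : E → F} (hf : Measurable f) :
    (discreteLaw y p).map f = discreteLaw (fun i => f (y i)) p := by
  ext s hs
  rw [Measure.map_apply hf hs]
  simp only [discreteLaw, Measure.coe_finsetSum, Finset.sum_apply, Measure.smul_apply,
    Measure.dirac_apply' _ hs, Measure.dirac_apply' _ (hf hs)]
  rfl

theorem isProbabilityMeasure_discreteLaw (y : Fin N → E) {p : Fin N → ℝ}
    (hp : p ∈ stdSimplex ℝ (Fin N)) : IsProbabilityMeasure (discreteLaw y p) := by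
  refine ⟨?_⟩
  simp only [discreteLaw, Measure.coe_finsetSum, Finset.sum_apply, Measure.smul_apply,
    measure_univ, smul_eq_mul, mul_one]
  rw [← ENNReal.ofReal_sum_of_nonneg fun i _ => hp.1 i, hp.2, ENNReal.ofReal_one]

theorem discreteLaw_real_apply (p : Fin N → ℝ) (hp : ∀ i, 0 ≤ p i) (y : Fin N → E) {s : Set E}
    (hs : MeasurableSet s) [DecidablePred fun i => y i ∈ s] :
    (discreteLaw y p).real s = ∑ i with y i ∈ s, p i := by
  simp only [Measure.real, discreteLaw, Measure.coe_finsetSum, Finset.sum_apply,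
    Measure.smul_apply, Measure.dirac_apply' _ hs, smul_eq_mul]
  rw [ENNReal.toReal_sum]
  · rw [Finset.sum_filter]
    refine Finset.sum_congr rfl fun i _ => ?_
    by_cases hi : y i ∈ s <;> simp [hi, hp i]
  · intro i _
    by_cases hi : y i ∈ s <;> simp [hi]

theorem ae_discreteLaw {y : Fin N → E} {p : Fin N → ℝ} {Pr : E → Prop}
    (hm : MeasurableSet {x | Pr x})
    (h : ∀ i, Pr (y i)) : ∀ᵐ x ∂(discreteLaw y p), Pr x := by
  rw [ae_iff]
  have hs : MeasurableSet {x | ¬ Pr x} := hm.compl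
  simp only [discreteLaw, Measure.coe_finsetSum, Finset.sum_apply, Measure.smul_apply,
    Measure.dirac_apply' _ hs]
  refine Finset.sum_eq_zero fun i _ => ?_
  have : y i ∉ {x | ¬ Pr x} := fun hi => hi (h i)
  simp [this]

end DiscreteLaw

theorem continuous_of_abs_sub_le {ℓ : ℝ → ℝ} {L : ℝ} (hℓ : ∀ x z, |ℓ x - ℓ z| ≤ L * |x - z|) :
    Continuous ℓ := by
  have : LipschitzWith (Real.toNNReal L) ℓ := LipschitzWith.of_dist_le_mul fun x z => by
    rw [Real.dist_eq, Real.dist_eq]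
    exact (hℓ x z).trans (mul_le_mul_of_nonneg_right (Real.le_coe_toNNReal L) (abs_nonneg _))
  exact this.continuous

theorem abs_loss_sub_le {E : Type*} [NormedAddCommGroup E] [NormedSpace ℝ E] {ℓ : ℝ → ℝ} {L : ℝ}
    (hL : 0 ≤ L) (hℓ : ∀ x z, |ℓ x - ℓ z| ≤ L * |x - z|) (α : StrongDual ℝ E)
    (a b : E) : |ℓ (α a) - ℓ (α b)| ≤ L * ‖α‖ * ‖a - b‖ := by
  refine (hℓ _ _).trans ?_
  rw [mul_assoc]
  refine mul_le_mul_of_nonneg_left ?_ hL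
  rw [← map_sub, ← Real.norm_eq_abs]
  exact α.le_opNorm _

theorem nonneg_of_mem_otBall {E : Type*} [MeasurableSpace E] {D : E → E → ℝ} {δ : ℝ}
    {P Q : Measure E} (hQ : Q ∈ otBall D δ P) : 0 ≤ δ := by
  have := (EReal.coe_ennreal_nonneg (otCost D Q P)).trans hQ.2
  exact_mod_cast this

/-- The slack ε avoids the question whether an optimal coupling exists. -/
theorem exists_coupling_of_mem_otBall {E : Type*} [MeasurableSpace E] {D : E → E → ℝ} {δ ε : ℝ}
    (hε : 0 < ε) {P Q : Measure E} (hQ : Q ∈ otBall D δ P) :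
    ∃ π, IsCoupling Q P π ∧ ∫⁻ z, ENNReal.ofReal (D z.1 z.2) ∂π ≤ ENNReal.ofReal (δ + ε) := by
  have hδ := nonneg_of_mem_otBall hQ
  have h1 : otCost D Q P ≤ ENNReal.ofReal δ := by
    have := hQ.2
    rw [← EReal.coe_ennreal_le_coe_ennreal_iff, EReal.coe_ennreal_ofReal, max_eq_left hδ]
    exact this
  have h2 : otCost D Q P < ENNReal.ofReal (δ + ε) :=
    h1.trans_lt ((ENNReal.ofReal_lt_ofReal_iff (by linarith)).2 (by linarith))
  rw [otCost, iInf_lt_iff] at h2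
  obtain ⟨π, hπ⟩ := h2
  rw [iInf_lt_iff] at hπ
  obtain ⟨hc, hlt⟩ := hπ
  exact ⟨π, hc, hlt.le⟩

/-! ### The upper bound on a transport ball -/

namespace Distortion

variable {h : Distortion}

theorem integrable_distortedLaw_of_bounded (hconv : ConvexOn ℝ (Icc 0 1) h)
    (hcont : Tendsto h (𝓝[<] 1) (𝓝 1)) {Ω : Type*} [MeasurableSpace Ω] (P : Measure Ω)
    [IsProbabilityMeasure P] {X : Ω → ℝ} (hX : Measurable X) {M : ℝ} (hM : ∀ᵐ ω ∂P, |X ω| ≤ M) :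
    Integrable (fun z : ℝ => z) (h.distortedLaw (P.map X)) := by
  obtain ⟨ρ, h1, h2, h3⟩ := exists_rank P hX
  rw [integrable_distortedLaw_iff hconv hcont measurable_snd h2 (hX.comp measurable_fst) h3]
  have hM' : ∀ᵐ w ∂ρ, |X w.1| ≤ M := ae_of_ae_map measurable_fst.aemeasurable (by rwa [h1])
  exact (integrable_density_comp hconv hcont measurable_snd h2).mul_bdd
    (hX.comp measurable_fst).aestronglyMeasurable hM'

section Holder

variable {Ω : Type*} [MeasurableSpace Ω] {P : Measure Ω} {U D : Ω → ℝ} {q c : ℝ} {qs : ℝ≥0∞}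

theorem eLpNorm_density_comp (hconv : ConvexOn ℝ (Icc 0 1) h) (hU : Measurable U)
    (hPU : P.map U = unifMeasure) (r : ℝ≥0∞) :
    eLpNorm (fun ω => h.density (U ω)) r P = h.leftDerivNorm r := by
  rw [leftDerivNorm_eq, ← hPU, eLpNorm_map_measure
    (measurable_density hconv).aestronglyMeasurable hU.aemeasurable]
  rfl

theorem eLpNorm_le_of_lintegral_le (hq : 1 ≤ q) (hD : ∀ ω, 0 ≤ D ω)
    (hDc : ∫⁻ ω, ENNReal.ofReal (D ω ^ q) ∂P ≤ ENNReal.ofReal c) (hc : 0 ≤ c) :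
    eLpNorm D (ENNReal.ofReal q) P ≤ ENNReal.ofReal (c ^ (1 / q)) := by
  have hq0 : 0 < q := by linarith
  rw [eLpNorm_eq_lintegral_rpow_enorm_toReal (by simpa using hq0) ENNReal.ofReal_ne_top,
    ENNReal.toReal_ofReal hq0.le, ← ENNReal.ofReal_rpow_of_nonneg hc (by positivity)]
  refine ENNReal.rpow_le_rpow (le_of_eq_of_le (lintegral_congr fun ω => ?_) hDc) (by positivity)
  rw [Real.enorm_of_nonneg (hD ω), ENNReal.ofReal_rpow_of_nonneg (hD ω) hq0.le]

/-- Hölder's inequality. The exponent `qs` is extended-real, so that q = 1 with `qs = ∞` is covered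
together with q > 1. -/
theorem integrable_density_mul (hconv : ConvexOn ℝ (Icc 0 1) h) (hU : Measurable U)
    (hPU : P.map U = unifMeasure) [ENNReal.HolderConjugate (ENNReal.ofReal q) qs]
    (hnorm : h.leftDerivNorm qs ≠ ∞) (hq : 1 ≤ q) (hDm : Measurable D) (hD : ∀ ω, 0 ≤ D ω)
    (hDc : ∫⁻ ω, ENNReal.ofReal (D ω ^ q) ∂P ≤ ENNReal.ofReal c) (hc : 0 ≤ c) :
    Integrable (fun ω => h.density (U ω) * D ω) P ∧
      ∫ ω, h.density (U ω) * D ω ∂P ≤ (h.leftDerivNorm qs).toReal * c ^ (1 / q) := by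
  have hDn := eLpNorm_le_of_lintegral_le hq hD hDc hc
  have hGm : Measurable fun ω => h.density (U ω) := (measurable_density hconv).comp hU
  have hGn := eLpNorm_density_comp hconv hU hPU qs
  have : ENNReal.HolderTriple qs (ENNReal.ofReal q) 1 := ENNReal.HolderTriple.symm
  have hle : eLpNorm (fun ω => h.density (U ω) * D ω) 1 P ≤
      h.leftDerivNorm qs * ENNReal.ofReal (c ^ (1 / q)) := by
    have := eLpNorm_smul_le_mul_eLpNorm (r := 1) (p := qs) (q := ENNReal.ofReal q)
      hDm.aestronglyMeasurable hGm.aestronglyMeasurable (μ := P)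
    rw [hGn] at this
    exact this.trans (by gcongr)
  have hlt : h.leftDerivNorm qs * ENNReal.ofReal (c ^ (1 / q)) ≠ ∞ :=
    ENNReal.mul_ne_top hnorm ENNReal.ofReal_ne_top
  have hint : Integrable (fun ω => h.density (U ω) * D ω) P :=
    memLp_one_iff_integrable.1 ⟨(hGm.mul hDm).aestronglyMeasurable, hle.trans_lt hlt.lt_top⟩
  refine ⟨hint, ?_⟩
  have h1 : ∫ ω, h.density (U ω) * D ω ∂P =
      (eLpNorm (fun ω => h.density (U ω) * D ω) 1 P).toReal := by
    rw [eLpNorm_one_eq_lintegral_enorm, ← integral_norm_eq_lintegral_enorm hint.1]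
    refine integral_congr_ae (Eventually.of_forall fun ω => ?_)
    exact (Real.norm_of_nonneg (mul_nonneg (density_nonneg hconv _) (hD ω))).symm
  rw [h1]
  refine (ENNReal.toReal_mono hlt hle).trans_eq ?_
  rw [ENNReal.toReal_mul, ENNReal.toReal_ofReal (by positivity)]

end Holder

section UpperBound

variable {E : Type*} [NormedAddCommGroup E] [NormedSpace ℝ E] [MeasurableSpace E]
  [BorelSpace E] [SecondCountableTopology E] {N : ℕ} {y : Fin N → E} {p : Fin N → ℝ}
  {ℓ : ℝ → ℝ} {L q c : ℝ} {qs : ℝ≥0∞}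

theorem lossRisk_le_of_coupling (hconv : ConvexOn ℝ (Icc 0 1) h)
    (hcont : Tendsto h (𝓝[<] 1) (𝓝 1)) (hp : p ∈ stdSimplex ℝ (Fin N))
    [ENNReal.HolderConjugate (ENNReal.ofReal q) qs] (hnorm : h.leftDerivNorm qs ≠ ∞)
    (hq : 1 ≤ q) (hL : 0 ≤ L) (hℓ : ∀ x z, |ℓ x - ℓ z| ≤ L * |x - z|) (α : StrongDual ℝ E)
    {Q : Measure E} [IsProbabilityMeasure Q] {π : Measure (E × E)}
    (hπ : IsCoupling Q (discreteLaw y p) π) (hc : 0 ≤ c)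
    (hcost : ∫⁻ z, ENNReal.ofReal (‖z.1 - z.2‖ ^ q) ∂π ≤ ENNReal.ofReal c) :
    Integrable (fun z : ℝ => z) (h.distortedLaw (Q.map (fun y => ℓ (α y)))) ∧
      lossRisk h ℓ α Q ≤ lossRisk h ℓ α (discreteLaw y p) +
        L * (h.leftDerivNorm qs).toReal * c ^ (1 / q) * ‖α‖ := by
  have hPp := isProbabilityMeasure_discreteLaw y hp
  have hπ1 : IsProbabilityMeasure π := by
    refine ⟨?_⟩
    rw [← preimage_univ (f := Prod.fst), ← Measure.map_apply measurable_fst MeasurableSet.univ,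
      hπ.1, measure_univ]
  have hℓc : Measurable fun e : E => ℓ (α e) :=
    ((continuous_of_abs_sub_le hℓ).comp α.continuous).measurable
  have hZ1 : Measurable fun z : E × E => ℓ (α z.1) := hℓc.comp measurable_fst
  obtain ⟨ρ, h1, h2, h3⟩ := exists_rank π hZ1
  have hρ := isProbabilityMeasure_of_map_eq_unif measurable_snd h2
  have eQ : π.map (fun z : E × E => ℓ (α z.1)) = Q.map fun e => ℓ (α e) := by
    rw [← hπ.1, Measure.map_map hℓc measurable_fst]; rfl
  have hX1 : Measurable fun w : (E × E) × ℝ => ℓ (α w.1.1) := hZ1.comp measurable_fst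
  have hX2 : Measurable fun w : (E × E) × ℝ => ℓ (α w.1.2) :=
    hℓc.comp (measurable_snd.comp measurable_fst)
  have eP : ρ.map (fun w : (E × E) × ℝ => ℓ (α w.1.2)) =
      (discreteLaw y p).map fun e => ℓ (α e) := by
    rw [← hπ.2, Measure.map_map hℓc measurable_snd, ← h1, Measure.map_map
      (hℓc.comp measurable_snd) measurable_fst]
    rfl
  rw [eQ] at h3
  set M := ∑ i, |ℓ (α (y i))| with hM
  have hbd : ∀ᵐ e ∂(discreteLaw y p), |ℓ (α e)| ≤ M := by
    refine ae_discreteLaw (Pr := fun e => |ℓ (α e)| ≤ M)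
      (measurableSet_le hℓc.abs measurable_const) fun i => ?_
    exact Finset.single_le_sum (f := fun i => |ℓ (α (y i))|) (fun i _ => abs_nonneg _)
      (Finset.mem_univ i)
  have hbd2 : ∀ᵐ w ∂ρ, |ℓ (α w.1.2)| ≤ M := by
    have e2 : ρ.map (fun w : (E × E) × ℝ => w.1.2) = discreteLaw y p := by
      rw [← hπ.2, ← h1, Measure.map_map measurable_snd measurable_fst]; rfl
    rw [← e2] at hbd
    exact ae_of_ae_map (measurable_snd.comp measurable_fst).aemeasurable hbd
  have hG := integrable_density_comp hconv hcont measurable_snd h2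
  have hGm : Measurable fun w : (E × E) × ℝ => h.density w.2 :=
    (measurable_density hconv).comp measurable_snd
  have hGX2 : Integrable (fun w : (E × E) × ℝ => h.density w.2 * ℓ (α w.1.2)) ρ :=
    hG.mul_bdd hX2.aestronglyMeasurable hbd2
  have hDm : Measurable fun w : (E × E) × ℝ => ‖w.1.1 - w.1.2‖ := by fun_prop
  have hcost' : ∫⁻ w, ENNReal.ofReal (‖w.1.1 - w.1.2‖ ^ q) ∂ρ ≤ ENNReal.ofReal c := by
    rw [← h1, lintegral_map (by fun_prop) measurable_fst] at hcost
    exact hcost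
  obtain ⟨hGD, hGDle⟩ := integrable_density_mul (U := Prod.snd) hconv measurable_snd h2 hnorm hq
    hDm (fun w => norm_nonneg _) hcost' hc
  have hZ := fun w : (E × E) × ℝ => abs_loss_sub_le hL hℓ α w.1.1 w.1.2
  have hGX1 : Integrable (fun w : (E × E) × ℝ => h.density w.2 * ℓ (α w.1.1)) ρ := by
    refine (hGX2.abs.add (hGD.const_mul (L * ‖α‖))).mono' (hGm.mul hX1).aestronglyMeasurable
      (Eventually.of_forall fun w => ?_)
    have hg := density_nonneg hconv w.2
    simp only [Real.norm_eq_abs, Pi.add_apply, abs_mul, abs_of_nonneg hg]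
    have := hZ w
    have h4 : |ℓ (α w.1.1)| ≤ |ℓ (α w.1.2)| + L * ‖α‖ * ‖w.1.1 - w.1.2‖ := by
      have := abs_add_le (ℓ (α w.1.1) - ℓ (α w.1.2)) (ℓ (α w.1.2))
      rw [sub_add_cancel] at this
      linarith [hZ w]
    calc h.density w.2 * |ℓ (α w.1.1)|
        ≤ h.density w.2 * (|ℓ (α w.1.2)| + L * ‖α‖ * ‖w.1.1 - w.1.2‖) :=
          mul_le_mul_of_nonneg_left h4 hg
      _ = _ := by ring
  refine ⟨(integrable_distortedLaw_iff hconv hcont measurable_snd h2 hX1 h3).2 hGX1, ?_⟩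
  -- The rank was built for the loss at the first marginal. At the second marginal it only gives an
  -- inequality, in the direction needed for an upper bound; at the first it gives equality.
  have hr2 := integral_mul_le_risk hconv hcont measurable_snd h2 hX2 hGX2
    (by rw [eP]; exact integrable_distortedLaw_of_bounded hconv hcont _ hℓc hbd)
  rw [eP] at hr2
  have hr1 := risk_eq_integral hconv hcont measurable_snd h2 hX1 h3
  calc lossRisk h ℓ α Q = ∫ w, h.density w.2 * ℓ (α w.1.1) ∂ρ := hr1
    _ ≤ ∫ w, (h.density w.2 * ℓ (α w.1.2) + L * ‖α‖ * (h.density w.2 * ‖w.1.1 - w.1.2‖)) ∂ρ := by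
        refine integral_mono hGX1 (hGX2.add (hGD.const_mul (L * ‖α‖))) fun w => ?_
        have hg := density_nonneg hconv w.2
        have h5 := (le_abs_self _).trans (hZ w)
        have h6 := mul_le_mul_of_nonneg_left h5 hg
        change h.density w.2 * ℓ (α w.1.1) ≤ h.density w.2 * ℓ (α w.1.2) +
          L * ‖α‖ * (h.density w.2 * ‖w.1.1 - w.1.2‖)
        linarith
    _ = ∫ w, h.density w.2 * ℓ (α w.1.2) ∂ρ +
          L * ‖α‖ * ∫ w, h.density w.2 * ‖w.1.1 - w.1.2‖ ∂ρ := by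
        rw [integral_add hGX2 (hGD.const_mul (L * ‖α‖)), integral_const_mul]
    _ ≤ h.risk ((discreteLaw y p).map fun e => ℓ (α e)) +
          L * ‖α‖ * ((h.leftDerivNorm qs).toReal * c ^ (1 / q)) :=
        add_le_add hr2 (mul_le_mul_of_nonneg_left hGDle (by positivity))
    _ = _ := by rw [lossRisk]; ring

/-- Couplings of cost at most δ + ε give the bound with δ + ε in place of δ; this is continuous in
ε, and ε tends to 0. -/
theorem lossRisk_le_of_mem_otBall (hconv : ConvexOn ℝ (Icc 0 1) h)
    (hcont : Tendsto h (𝓝[<] 1) (𝓝 1)) (hp : p ∈ stdSimplex ℝ (Fin N))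
    [ENNReal.HolderConjugate (ENNReal.ofReal q) qs] (hnorm : h.leftDerivNorm qs ≠ ∞)
    (hq : 1 ≤ q) (hL : 0 ≤ L) (hℓ : ∀ x z, |ℓ x - ℓ z| ≤ L * |x - z|) (α : StrongDual ℝ E)
    {Q : Measure E} {δ : ℝ} (hQ : Q ∈ otBall (fun a b : E => ‖a - b‖ ^ q) δ (discreteLaw y p)) :
    Integrable (fun z : ℝ => z) (h.distortedLaw (Q.map (fun y => ℓ (α y)))) ∧
      lossRisk h ℓ α Q ≤ lossRisk h ℓ α (discreteLaw y p) +
        L * (h.leftDerivNorm qs).toReal * δ ^ (1 / q) * ‖α‖ := by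
  have := hQ.1
  have hδ := nonneg_of_mem_otBall hQ
  have key : ∀ ε : ℝ, 0 < ε → _ := fun ε hε =>
    let ⟨_, hc, hle⟩ := exists_coupling_of_mem_otBall hε hQ
    lossRisk_le_of_coupling hconv hcont hp hnorm hq hL hℓ α hc (by linarith) hle
  refine ⟨(key 1 one_pos).1, ?_⟩
  have hq0 : 0 ≤ 1 / q := by positivity
  have ht : Tendsto (fun ε : ℝ => lossRisk h ℓ α (discreteLaw y p) +
        L * (h.leftDerivNorm qs).toReal * (δ + ε) ^ (1 / q) * ‖α‖) (𝓝[>] 0)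
      (𝓝 (lossRisk h ℓ α (discreteLaw y p) +
        L * (h.leftDerivNorm qs).toReal * δ ^ (1 / q) * ‖α‖)) := by
    have hcn : Continuous fun ε : ℝ => lossRisk h ℓ α (discreteLaw y p) +
        L * (h.leftDerivNorm qs).toReal * (δ + ε) ^ (1 / q) * ‖α‖ := by
      have : Continuous fun ε : ℝ => (δ + ε) ^ (1 / q) :=
        (Real.continuous_rpow_const hq0).comp (continuous_const.add continuous_id)
      fun_prop
    have := hcn.tendsto 0
    rw [add_zero] at this
    exact this.mono_left nhdsWithin_le_nhds
  refine ge_of_tendsto ht ?_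
  filter_upwards [self_mem_nhdsWithin] with ε hε using (key ε hε).2

end UpperBound

end Distortion

/-! ### The risk envelope of a discrete law -/

namespace Distortion

variable {h : Distortion} {N : ℕ} {p : Fin N → ℝ}

theorem integrable_discreteLaw (z : Fin N → ℝ) (pb : Fin N → ℝ) :
    Integrable (fun x : ℝ => x) (discreteLaw z pb) := by
  rw [discreteLaw, integrable_finsetSum_measure]
  exact fun i _ => (integrable_dirac (by simp)).smul_measure ENNReal.ofReal_ne_top

theorem integral_discreteLaw (z : Fin N → ℝ) {pb : Fin N → ℝ} (hpb : ∀ i, 0 ≤ pb i) :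
    ∫ x, x ∂(discreteLaw z pb) = ∑ i, pb i * z i := by
  rw [discreteLaw, integral_finsetSum_measure
    fun i _ => (integrable_dirac (by simp)).smul_measure ENNReal.ofReal_ne_top]
  refine Finset.sum_congr rfl fun i _ => ?_
  rw [integral_smul_measure, integral_dirac, ENNReal.toReal_ofReal (hpb i), smul_eq_mul]

theorem integrable_distortedLaw_discreteLaw (hconv : ConvexOn ℝ (Icc 0 1) h)
    (hcont : Tendsto h (𝓝[<] 1) (𝓝 1)) (hp : p ∈ stdSimplex ℝ (Fin N)) (z : Fin N → ℝ) :
    Integrable (fun x : ℝ => x) (h.distortedLaw (discreteLaw z p)) := by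
  have := isProbabilityMeasure_discreteLaw z hp
  have h1 := integrable_distortedLaw_of_bounded hconv hcont (discreteLaw z p) (X := id)
    measurable_id (M := ∑ i, |z i|) (ae_discreteLaw (Pr := fun x => |id x| ≤ ∑ i, |z i|)
      (measurableSet_le (by fun_prop) measurable_const) fun i =>
        Finset.single_le_sum (f := fun i => |z i|) (fun i _ => abs_nonneg _) (Finset.mem_univ i))
  rwa [Measure.map_id] at h1

/-- The envelope constraints for the index sets {i : z i ≤ t} say that the law with weights `pb` is
stochastically dominated by the distorted law. -/
theorem sum_mul_le_risk (hconv : ConvexOn ℝ (Icc 0 1) h) (hcont : Tendsto h (𝓝[<] 1) (𝓝 1))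
    (hp : p ∈ stdSimplex ℝ (Fin N)) (z : Fin N → ℝ) {pb : Fin N → ℝ}
    (hpb : pb ∈ riskEnvelope h p) : ∑ i, pb i * z i ≤ h.risk (discreteLaw z p) := by
  obtain ⟨hsum, hnn, hJ⟩ := hpb
  have := isProbabilityMeasure_discreteLaw z hp
  have := isProbabilityMeasure_discreteLaw z (p := pb) ⟨hnn, hsum⟩
  have := isProbabilityMeasure_distortedLaw hconv hcont (discreteLaw z p)
  rw [← integral_discreteLaw z hnn, risk]
  refine integral_id_le_of_cdf_le (integrable_distortedLaw_discreteLaw hconv hcont hp z)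
    (integrable_discreteLaw z pb) fun t => ?_
  classical
  rw [distortedLaw_Iic hconv hcont, cdf_eq_real, ← ofReal_measureReal (μ := discreteLaw z pb),
    discreteLaw_real_apply p hp.1 z measurableSet_Iic,
    discreteLaw_real_apply pb hnn z measurableSet_Iic]
  exact ENNReal.ofReal_le_ofReal (hJ _)

section Rank

variable {ρ : Measure (Fin N × ℝ)}

variable (h ρ) in
/-- The weights of the atoms after the change of measure with density `h'(U)`. -/
def tiltWeights (i : Fin N) : ℝ := ∫ w in Prod.fst ⁻¹' {i}, h.density w.2 ∂ρ

theorem sum_tiltWeights (hconv : ConvexOn ℝ (Icc 0 1) h) (hcont : Tendsto h (𝓝[<] 1) (𝓝 1))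
    (h2 : ρ.map Prod.snd = unifMeasure) (J : Finset (Fin N)) :
    ∑ i ∈ J, tiltWeights h ρ i = ∫ w in Prod.fst ⁻¹' (J : Set (Fin N)), h.density w.2 ∂ρ := by
  have hG := integrable_density_comp hconv hcont measurable_snd h2
  have : Prod.fst ⁻¹' (J : Set (Fin N)) =
      ⋃ i ∈ J, (Prod.fst ⁻¹' {i} : Set (Fin N × ℝ)) := by
    ext w; simp
  rw [this, integral_biUnion_finset]
  · rfl
  · exact fun i _ => measurable_fst (measurableSet_singleton i)
  · exact fun i _ j _ hij => Disjoint.preimage _ (by simpa using hij)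
  · exact fun i _ => hG.integrableOn

theorem tiltWeights_mem_riskEnvelope (hconv : ConvexOn ℝ (Icc 0 1) h)
    (hcont : Tendsto h (𝓝[<] 1) (𝓝 1)) (hp : p ∈ stdSimplex ℝ (Fin N))
    (h1 : ρ.map Prod.fst = discreteLaw id p) (h2 : ρ.map Prod.snd = unifMeasure) :
    tiltWeights h ρ ∈ riskEnvelope h p := by
  refine ⟨?_, fun i => ?_, fun J => ?_⟩
  · rw [sum_tiltWeights hconv hcont h2]
    simp [integral_density_comp hconv hcont measurable_snd h2]
  · exact integral_nonneg fun w => density_nonneg hconv _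
  · rw [sum_tiltWeights hconv hcont h2]
    have hB : MeasurableSet (Prod.fst ⁻¹' (J : Set (Fin N)) : Set (Fin N × ℝ)) :=
      measurable_fst J.measurableSet
    refine le_of_eq_of_le ?_ (le_setIntegral_density hconv hcont measurable_snd h2 hB)
    classical
    rw [← map_measureReal_apply measurable_fst J.measurableSet, h1,
      discreteLaw_real_apply p hp.1 id J.measurableSet]
    simp

theorem integral_density_mul_eq_sum (hconv : ConvexOn ℝ (Icc 0 1) h)
    (hcont : Tendsto h (𝓝[<] 1) (𝓝 1)) (h2 : ρ.map Prod.snd = unifMeasure) (z : Fin N → ℝ) :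
    ∫ w, h.density w.2 * z w.1 ∂ρ = ∑ i, tiltWeights h ρ i * z i := by
  have hG := integrable_density_comp hconv hcont measurable_snd h2
  have hsplit : ∀ w : Fin N × ℝ, h.density w.2 * z w.1 =
      ∑ i, (Prod.fst ⁻¹' {i} : Set (Fin N × ℝ)).indicator (fun w => h.density w.2 * z i) w := by
    intro w
    rw [Finset.sum_eq_single w.1]
    · simp
    · intro i _ hi
      rw [indicator_of_notMem]
      exact fun hw => hi (Eq.symm hw)
    · simp
  have hm : ∀ i : Fin N, MeasurableSet (Prod.fst ⁻¹' {i} : Set (Fin N × ℝ)) :=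
    fun i => measurable_fst (measurableSet_singleton i)
  simp_rw [hsplit]
  rw [integral_finsetSum _ fun i _ => (hG.mul_const (z i)).indicator (hm i)]
  refine Finset.sum_congr rfl fun i _ => ?_
  rw [integral_indicator (hm i), integral_mul_const, tiltWeights]

end Rank

theorem exists_rank_discreteLaw (hp : p ∈ stdSimplex ℝ (Fin N)) (z : Fin N → ℝ) :
    ∃ ρ : Measure (Fin N × ℝ), ρ.map Prod.fst = discreteLaw id p ∧ ρ.map Prod.snd = unifMeasure ∧
      ∀ᵐ w ∂ρ, z w.1 = quantile (discreteLaw z p) w.2 := by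
  have := isProbabilityMeasure_discreteLaw (id : Fin N → Fin N) hp
  have h1 := exists_rank (discreteLaw id p) (Measurable.of_discrete (f := z))
  rwa [map_discreteLaw _ _ Measurable.of_discrete] at h1

/-- Tilting by the rank of z and collecting the mass on each atom gives weights that attain the
risk. The space is the index set times ℝ, so that atoms with equal values z i stay distinct. -/
theorem exists_mem_riskEnvelope (hconv : ConvexOn ℝ (Icc 0 1) h)
    (hcont : Tendsto h (𝓝[<] 1) (𝓝 1)) (hp : p ∈ stdSimplex ℝ (Fin N)) (z : Fin N → ℝ) :
    ∃ pb ∈ riskEnvelope h p, ∑ i, pb i * z i = h.risk (discreteLaw z p) := by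
  obtain ⟨ρ, h1, h2, h3⟩ := exists_rank_discreteLaw hp z
  refine ⟨tiltWeights h ρ, tiltWeights_mem_riskEnvelope hconv hcont hp h1 h2, ?_⟩
  rw [← integral_density_mul_eq_sum hconv hcont h2, risk_eq_integral hconv hcont measurable_snd h2
    (X := fun w => z w.1) (Measurable.of_discrete.comp measurable_fst) h3]

/-! ### Perturbed laws inside a transport ball -/

section LowerBound

variable {E : Type*} [NormedAddCommGroup E] [NormedSpace ℝ E] [MeasurableSpace E]
  [BorelSpace E] {y : Fin N → E}
  {ℓ : ℝ → ℝ} {L q δ : ℝ} {qs : ℝ≥0∞}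

theorem lossRisk_discreteLaw (hℓ : Continuous ℓ) (α : StrongDual ℝ E) :
    lossRisk h ℓ α (discreteLaw y p) = h.risk (discreteLaw (fun i => ℓ (α (y i))) p) := by
  rw [lossRisk, map_discreteLaw y p (f := fun e => ℓ (α e)) (hℓ.comp α.continuous).measurable]

variable [SecondCountableTopology E]

/-- Shifting the atom `y i` at the rank `u` by the distance `t u` into the direction `± e`, where
`e` is a unit vector at which `α` attains its norm. -/
theorem exists_mem_otBall_le_lossRisk (hconv : ConvexOn ℝ (Icc 0 1) h)
    (hcont : Tendsto h (𝓝[<] 1) (𝓝 1)) (hp : p ∈ stdSimplex ℝ (Fin N))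
    [ENNReal.HolderConjugate (ENNReal.ofReal q) qs] (hnorm : h.leftDerivNorm qs ≠ ∞)
    (hq : 1 ≤ q) (hL : 0 ≤ L) (hℓ : ∀ x z, |ℓ x - ℓ z| ≤ L * |x - z|) (α : StrongDual ℝ E)
    (hδ : 0 ≤ δ) {e : E} (he : ‖e‖ ≤ 1) (hαe : α e = ‖α‖) {s : Fin N → ℝ} (hs : ∀ i, |s i| = 1)
    {t : ℝ → ℝ} (ht : Measurable t) (ht0 : ∀ u, 0 ≤ t u)
    (htδ : ∫⁻ u, ENNReal.ofReal (t u ^ q) ∂unifMeasure ≤ ENNReal.ofReal δ)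
    {β : ℝ → ℝ} (hβ : Integrable (fun u => h.density u * β u) unifMeasure)
    (hle : ∀ i u, ℓ (α (y i)) + β u ≤ ℓ (α (y i) + s i * (t u * ‖α‖))) :
    ∃ Q ∈ otBall (fun a b : E => ‖a - b‖ ^ q) δ (discreteLaw y p),
      lossRisk h ℓ α (discreteLaw y p) + ∫ u, h.density u * β u ∂unifMeasure ≤
        lossRisk h ℓ α Q := by
  set z : Fin N → ℝ := fun i => ℓ (α (y i)) with hz
  have hq0 : 0 < q := by linarith
  obtain ⟨ρ, h1, h2, h3⟩ := exists_rank_discreteLaw hp z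
  have hρ := isProbabilityMeasure_of_map_eq_unif measurable_snd h2
  have hℓc := continuous_of_abs_sub_le hℓ
  have hyw : Measurable fun w : Fin N × ℝ => y w.1 := Measurable.of_discrete.comp measurable_fst
  have hzw : Measurable fun w : Fin N × ℝ => z w.1 :=
    (Measurable.of_discrete (f := z)).comp measurable_fst
  have hsw : Measurable fun w : Fin N × ℝ => s w.1 := Measurable.of_discrete.comp measurable_fst
  set Y : Fin N × ℝ → E := fun w => y w.1 + (s w.1 * t w.2) • e with hY
  have hYm : Measurable Y :=
    hyw.add ((hsw.mul (ht.comp measurable_snd)).smul_const e)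
  have hℓα : Measurable fun e : E => ℓ (α e) := (hℓc.comp α.continuous).measurable
  have hQ : ρ.map Y ∈ otBall (fun a b : E => ‖a - b‖ ^ q) δ (discreteLaw y p) := by
    refine ⟨Measure.isProbabilityMeasure_map hYm.aemeasurable, ?_⟩
    have hcost : otCost (fun a b : E => ‖a - b‖ ^ q) (ρ.map Y) (discreteLaw y p) ≤
        ENNReal.ofReal δ := by
      have hYy : Measurable fun w => (Y w, y w.1) := hYm.prodMk hyw
      -- The joint law of the shifted and the unshifted atom is a coupling under which the
      -- displacement is at most t at the rank.
      have hcoup : IsCoupling (ρ.map Y) (discreteLaw y p) (ρ.map fun w => (Y w, y w.1)) := by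
        constructor
        · rw [Measure.map_map measurable_fst hYy]; rfl
        · rw [Measure.map_map measurable_snd hYy]
          have : discreteLaw y p = (discreteLaw id p).map y :=
            (map_discreteLaw id p Measurable.of_discrete).symm
          rw [this, ← h1, Measure.map_map Measurable.of_discrete measurable_fst]
          rfl
      refine (iInf₂_le _ hcoup).trans ?_
      rw [lintegral_map (by fun_prop) hYy]
      refine le_trans ?_ htδ
      rw [← h2, lintegral_map (by fun_prop) measurable_snd]
      refine lintegral_mono fun w => ENNReal.ofReal_le_ofReal ?_
      refine Real.rpow_le_rpow (norm_nonneg _) ?_ hq0.le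
      change ‖y w.1 + (s w.1 * t w.2) • e - y w.1‖ ≤ t w.2
      rw [add_sub_cancel_left, norm_smul, Real.norm_eq_abs, abs_mul, hs, one_mul,
        abs_of_nonneg (ht0 _)]
      exact mul_le_of_le_one_right (ht0 _) he
    have := EReal.coe_ennreal_le_coe_ennreal_iff.2 hcost
    rwa [EReal.coe_ennreal_ofReal, max_eq_left hδ] at this
  refine ⟨_, hQ, ?_⟩
  have hαY : ∀ w, α (Y w) = α (y w.1) + s w.1 * (t w.2 * ‖α‖) := by
    intro w
    simp only [hY, map_add, map_smul, hαe, smul_eq_mul]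
    ring
  have hG := integrable_density_comp hconv hcont measurable_snd h2
  have hGm : Measurable fun w : Fin N × ℝ => h.density w.2 :=
    (measurable_density hconv).comp measurable_snd
  obtain ⟨hGt, -⟩ := integrable_density_mul (P := unifMeasure) (U := id) hconv measurable_id
    Measure.map_id hnorm hq ht ht0 htδ hδ
  have hGt' : Integrable (fun w : Fin N × ℝ => h.density w.2 * t w.2) ρ := by
    rw [← h2] at hGt
    exact hGt.comp_measurable measurable_snd
  have hGβ : Integrable (fun w : Fin N × ℝ => h.density w.2 * β w.2) ρ := by
    rw [← h2] at hβ
    exact hβ.comp_measurable measurable_snd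
  have hGz : Integrable (fun w : Fin N × ℝ => h.density w.2 * z w.1) ρ := by
    refine hG.mul_bdd (c := ∑ i, |z i|) hzw.aestronglyMeasurable (Eventually.of_forall fun w => ?_)
    exact Finset.single_le_sum (f := fun i => |z i|) (fun i _ => abs_nonneg _) (Finset.mem_univ _)
  have hXm : Measurable fun w => ℓ (α (Y w)) := hℓα.comp hYm
  have hX : Integrable (fun w : Fin N × ℝ => h.density w.2 * ℓ (α (Y w))) ρ := by
    refine (hGz.abs.add (hGt'.const_mul (L * ‖α‖))).mono' (hGm.mul hXm).aestronglyMeasurable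
      (Eventually.of_forall fun w => ?_)
    have hg := density_nonneg hconv w.2
    simp only [Real.norm_eq_abs, Pi.add_apply, abs_mul, abs_of_nonneg hg]
    have h4 : |ℓ (α (Y w))| ≤ |z w.1| + L * ‖α‖ * t w.2 := by
      have h5 := hℓ (α (Y w)) (α (y w.1))
      rw [hαY w, add_sub_cancel_left, abs_mul, hs, one_mul,
        abs_of_nonneg (mul_nonneg (ht0 _) (norm_nonneg _)), ← hαY w] at h5
      have := abs_add_le (ℓ (α (Y w)) - z w.1) (z w.1)
      rw [sub_add_cancel] at this
      have h6 : |ℓ (α (Y w)) - z w.1| ≤ L * (t w.2 * ‖α‖) := h5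
      linarith
    calc h.density w.2 * |ℓ (α (Y w))| ≤ h.density w.2 * (|z w.1| + L * ‖α‖ * t w.2) :=
          mul_le_mul_of_nonneg_left h4 hg
      _ = _ := by ring
  have hmap : (ρ.map Y).map (fun e => ℓ (α e)) = ρ.map fun w => ℓ (α (Y w)) :=
    Measure.map_map hℓα hYm
  -- Absolute convergence of the new risk is already part of the upper bound.
  have hXi := (lossRisk_le_of_mem_otBall hconv hcont hp hnorm hq hL hℓ α hQ).1
  rw [hmap] at hXi
  -- The rank is that of the unshifted loss and need not be one of the shifted loss; the resulting
  -- inequality goes the favourable way.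
  have hr := integral_mul_le_risk hconv hcont measurable_snd h2 hXm hX hXi
  rw [lossRisk_discreteLaw hℓc, lossRisk, hmap,
    risk_eq_integral hconv hcont measurable_snd h2 hzw h3]
  refine le_trans ?_ hr
  have e3 : ∫ u, h.density u * β u ∂unifMeasure = ∫ w, h.density w.2 * β w.2 ∂ρ := by
    have hm := hβ.1
    rw [← h2] at hm ⊢
    exact integral_map measurable_snd.aemeasurable hm
  rw [e3, ← integral_add hGz hGβ]
  refine integral_mono (hGz.add hGβ) hX fun w => ?_
  have h7 := mul_le_mul_of_nonneg_left (hle w.1 w.2) (density_nonneg hconv w.2)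
  rw [← hαY w, mul_add] at h7
  exact h7

end LowerBound

end Distortion

/-! ### Growth of the loss function -/

section Loss

variable {ℓ : ℝ → ℝ} {C : ℝ}

theorem lipConst_nonneg (ℓ : ℝ → ℝ) : 0 ≤ lipConst ℓ := Real.sInf_nonneg fun _ hK => hK.1

theorem abs_sub_le_lipConst (hℓ : ∃ K : ℝ, ∀ x z, |ℓ x - ℓ z| ≤ K * |x - z|) (x z : ℝ) :
    |ℓ x - ℓ z| ≤ lipConst ℓ * |x - z| := by
  obtain ⟨K, hK⟩ := hℓ
  have hne : {K : ℝ | 0 ≤ K ∧ ∀ x y, |ℓ x - ℓ y| ≤ K * |x - y|}.Nonempty := by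
    refine ⟨max K 0, le_max_right _ _, fun x y => (hK x y).trans ?_⟩
    exact mul_le_mul_of_nonneg_right (le_max_left _ _) (abs_nonneg _)
  rcases eq_or_ne x z with rfl | hxz
  · simp
  have hpos : 0 < |x - z| := abs_pos.2 (sub_ne_zero.2 hxz)
  rw [← div_le_iff₀ hpos]
  exact le_csInf hne fun K' hK' => (div_le_iff₀ hpos).2 (hK'.2 x z)

/-- A convex function grows at least at every rate below its Lipschitz constant, in one of the
two directions. -/
theorem exists_ray_of_lt_lipConst (hconv : ConvexOn ℝ univ ℓ) {K : ℝ} (hK0 : 0 ≤ K)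
    (hK : K < lipConst ℓ) :
    ∃ s w : ℝ, |s| = 1 ∧ ∀ t, 0 ≤ t → ℓ w + K * t ≤ ℓ (w + s * t) := by
  have hnot : ¬ ∀ x z, |ℓ x - ℓ z| ≤ K * |x - z| := fun hall =>
    not_le.2 hK (csInf_le (s := {K : ℝ | 0 ≤ K ∧ ∀ x y, |ℓ x - ℓ y| ≤ K * |x - y|})
      ⟨0, fun _ hx => hx.1⟩ ⟨hK0, hall⟩)
  push Not at hnot
  obtain ⟨a, b, hab⟩ := hnot
  obtain ⟨x, z, hxz, hlt⟩ : ∃ x z, x < z ∧ K * (z - x) < |ℓ z - ℓ x| := by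
    rcases lt_trichotomy a b with h | h | h
    · refine ⟨a, b, h, ?_⟩
      rwa [abs_sub_comm a b, abs_of_pos (sub_pos.2 h), abs_sub_comm] at hab
    · simp [h] at hab
    · refine ⟨b, a, h, ?_⟩
      rwa [abs_of_pos (sub_pos.2 h)] at hab
  have hpos : 0 < z - x := sub_pos.2 hxz
  -- The secant over [x, z] is steeper than `K`; by convexity the slopes to the right of z are at
  -- least as large if it ascends, and those to the left of x at least as steep if it descends.
  rcases lt_abs.1 hlt with h | h
  · refine ⟨1, z, abs_one, fun t ht => ?_⟩
    rcases eq_or_lt_of_le ht with rfl | ht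
    · simp
    have h1 := hconv.slope_mono_adjacent (mem_univ x) (mem_univ (z + t)) hxz
      (by linarith : z < z + t)
    have h2 : K < (ℓ z - ℓ x) / (z - x) := (lt_div_iff₀ hpos).2 h
    have h3 := h2.le.trans h1
    rw [add_sub_cancel_left, le_div_iff₀ ht] at h3
    rw [one_mul]; linarith
  · refine ⟨-1, x, by simp, fun t ht => ?_⟩
    rcases eq_or_lt_of_le ht with rfl | ht
    · simp
    have h1 := hconv.slope_mono_adjacent (mem_univ (x - t)) (mem_univ z)
      (by linarith : x - t < x) hxz
    have h2 : (ℓ z - ℓ x) / (z - x) < -K := (div_lt_iff₀ hpos).2 (by linarith)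
    have h3 := h1.trans h2.le
    rw [sub_sub_cancel, div_le_iff₀ ht] at h3
    rw [neg_one_mul, ← sub_eq_add_neg]; linarith

theorem IsSpecialLoss.abs_sub_le (hC : 0 < C) (hℓ : IsSpecialLoss C ℓ) (x z : ℝ) :
    |ℓ x - ℓ z| ≤ C * |x - z| := by
  rcases hℓ with ⟨b, hb⟩ | ⟨b, hb⟩ | ⟨b₁, b₂, hb⟩
  · rw [hb, hb, ← mul_sub, abs_mul, abs_of_pos hC, add_sub_add_right_eq_sub]
  · rw [hb, hb, ← mul_sub, abs_mul, abs_of_pos hC, add_sub_add_right_eq_sub, abs_sub_comm]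
    simp [neg_add_eq_sub]
  · rw [hb, hb, ← mul_sub, abs_mul, abs_of_pos hC, add_sub_add_right_eq_sub]
    refine mul_le_mul_of_nonneg_left ((abs_abs_sub_abs_le _ _).trans_eq ?_) hC.le
    rw [sub_sub_sub_cancel_right]

theorem IsSpecialLoss.convexOn (hC : 0 < C) (hℓ : IsSpecialLoss C ℓ) : ConvexOn ℝ univ ℓ := by
  refine ⟨convex_univ, fun x _ z _ a b ha hb hab => ?_⟩
  simp only [smul_eq_mul]
  have hba : b = 1 - a := by linarith
  rcases hℓ with ⟨c, hc⟩ | ⟨c, hc⟩ | ⟨b₁, b₂, hc⟩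
  · rw [hc, hc, hc, hba]; apply le_of_eq; ring
  · rw [hc, hc, hc, hba]; apply le_of_eq; ring
  · rw [hc, hc, hc]
    have h1 : |a * x + b * z - b₁| ≤ a * |x - b₁| + b * |z - b₁| := by
      have : a * x + b * z - b₁ = a * (x - b₁) + b * (z - b₁) := by rw [hba]; ring
      rw [this]
      refine (abs_add_le _ _).trans_eq ?_
      rw [abs_mul, abs_mul, abs_of_nonneg ha, abs_of_nonneg hb]
    have h2 := mul_le_mul_of_nonneg_left h1 hC.le
    have h3 : a * (C * (|x - b₁| + b₂)) + b * (C * (|z - b₁| + b₂)) =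
        C * (a * |x - b₁| + b * |z - b₁|) + C * b₂ := by rw [hba]; ring
    rw [h3, mul_add]; linarith

/-- For q > 1 the optimal shifts are bounded in the mean, so the loss must grow at its full slope
from every point, not merely far away. The sign depends on the side of the kink on which x lies. -/
theorem IsSpecialLoss.exists_sign (hC : 0 < C) (hℓ : IsSpecialLoss C ℓ) (x : ℝ) :
    ∃ s : ℝ, |s| = 1 ∧ ∀ t, 0 ≤ t → ℓ x + C * t ≤ ℓ (x + s * t) := by
  rcases hℓ with ⟨b, hb⟩ | ⟨b, hb⟩ | ⟨b₁, b₂, hb⟩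
  · exact ⟨1, abs_one, fun t _ => by rw [hb, hb]; apply le_of_eq; ring⟩
  · exact ⟨-1, by simp, fun t _ => by rw [hb, hb]; apply le_of_eq; ring⟩
  · rcases le_total b₁ x with h | h
    · refine ⟨1, abs_one, fun t _ => ?_⟩
      rw [hb, hb, abs_of_nonneg (sub_nonneg.2 h)]
      have := mul_le_mul_of_nonneg_left (le_abs_self (x + 1 * t - b₁)) hC.le
      linarith
    · refine ⟨-1, by simp, fun t _ => ?_⟩
      rw [hb, hb, abs_of_nonpos (sub_nonpos.2 h)]
      have := mul_le_mul_of_nonneg_left (neg_le_abs (x + -1 * t - b₁)) hC.le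
      linarith

end Loss

theorem exists_norm_le_one_apply_eq {E : Type*} [NormedAddCommGroup E] [NormedSpace ℝ E]
    [FiniteDimensional ℝ E] (α : StrongDual ℝ E) : ∃ e : E, ‖e‖ ≤ 1 ∧ α e = ‖α‖ := by
  have := FiniteDimensional.proper_real E
  obtain ⟨e, he, hmax⟩ := (isCompact_closedBall (0 : E) 1).exists_isMaxOn
    ⟨0, by simp⟩ (α.continuous.norm.continuousOn)
  have he1 : ‖e‖ ≤ 1 := by simpa using he
  have hle : ‖α‖ ≤ ‖α e‖ := by
    refine α.opNorm_le_of_unit_norm (norm_nonneg _) fun x hx => ?_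
    exact hmax (by simp [hx])
  have heq : ‖α e‖ = ‖α‖ :=
    le_antisymm ((α.le_opNorm e).trans (mul_le_of_le_one_right (norm_nonneg _) he1)) hle
  rcases le_total 0 (α e) with h | h
  · exact ⟨e, he1, by rw [← heq, Real.norm_of_nonneg h]⟩
  · exact ⟨-e, by simpa using he1, by rw [map_neg, ← heq, Real.norm_of_nonpos h]⟩

/-! ### Nearly worst-case laws in the two cases -/

namespace Distortion

variable {h : Distortion} {N : ℕ} {p : Fin N → ℝ}

theorem leftDerivNorm_ne_zero (hconv : ConvexOn ℝ (Icc 0 1) h)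
    (hcont : Tendsto h (𝓝[<] 1) (𝓝 1)) {r : ℝ≥0∞} (hr : r ≠ 0) : h.leftDerivNorm r ≠ 0 := by
  rw [leftDerivNorm_eq]
  intro h0
  rw [eLpNorm_eq_zero_iff (measurable_density hconv).aestronglyMeasurable hr] at h0
  have := integral_congr_ae h0
  rw [integral_density hconv hcont] at this
  simp at this

/-- Together with monotonicity this yields a whole interval up to 1 on which the density exceeds
`K`. -/
theorem exists_lt_density (hconv : ConvexOn ℝ (Icc 0 1) h)
    {K : ℝ} (hK0 : 0 ≤ K) (hK : K < (h.leftDerivNorm ∞).toReal) :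
    ∃ u ∈ Ioo (0 : ℝ) 1, K < h.density u := by
  by_contra! hcon
  have hle : h.leftDerivNorm ∞ ≤ ENNReal.ofReal K := by
    rw [leftDerivNorm_eq, eLpNorm_exponent_top]
    refine eLpNormEssSup_le_of_ae_bound ?_
    filter_upwards [ae_unifMeasure_mem] with u hu
    rw [Real.norm_of_nonneg (density_nonneg hconv u)]
    exact hcon u hu
  have := ENNReal.toReal_mono ENNReal.ofReal_ne_top hle
  rw [ENNReal.toReal_ofReal hK0] at this
  linarith

theorem lintegral_density_rpow (hconv : ConvexOn ℝ (Icc 0 1) h) {r : ℝ} (hr : 0 < r)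
    (hnorm : h.leftDerivNorm (ENNReal.ofReal r) ≠ ∞) :
    ∫⁻ u, ENNReal.ofReal (h.density u ^ r) ∂unifMeasure =
      ENNReal.ofReal ((h.leftDerivNorm (ENNReal.ofReal r)).toReal ^ r) := by
  rw [← ENNReal.ofReal_rpow_of_nonneg ENNReal.toReal_nonneg hr.le, ENNReal.ofReal_toReal hnorm,
    leftDerivNorm_eq, eLpNorm_eq_lintegral_rpow_enorm_toReal (by simpa using hr)
    ENNReal.ofReal_ne_top, ENNReal.toReal_ofReal hr.le, ← ENNReal.rpow_mul,
    one_div_mul_cancel hr.ne', ENNReal.rpow_one]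
  refine lintegral_congr fun u => ?_
  rw [Real.enorm_of_nonneg (density_nonneg hconv u),
    ENNReal.ofReal_rpow_of_nonneg (density_nonneg hconv u) hr.le]

theorem integral_density_rpow (hconv : ConvexOn ℝ (Icc 0 1) h) {r : ℝ} (hr : 0 < r)
    (hnorm : h.leftDerivNorm (ENNReal.ofReal r) ≠ ∞) :
    Integrable (fun u => h.density u ^ r) unifMeasure ∧ ∫ u, h.density u ^ r ∂unifMeasure =
      (h.leftDerivNorm (ENNReal.ofReal r)).toReal ^ r := by
  have hl := lintegral_density_rpow hconv hr hnorm
  have hm : AEStronglyMeasurable (fun u => h.density u ^ r) unifMeasure :=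
    ((measurable_density hconv).pow_const r).aestronglyMeasurable
  have hn : 0 ≤ᵐ[unifMeasure] fun u => h.density u ^ r :=
    Eventually.of_forall fun u => Real.rpow_nonneg (density_nonneg hconv u) r
  constructor
  · refine ⟨hm, ?_⟩
    rw [hasFiniteIntegral_iff_ofReal hn, hl]
    exact ENNReal.ofReal_lt_top
  · rw [integral_eq_lintegral_of_nonneg_ae hn hm, hl, ENNReal.toReal_ofReal (by positivity)]

variable {E : Type*} [NormedAddCommGroup E] [NormedSpace ℝ E] [MeasurableSpace E]
  [BorelSpace E] [FiniteDimensional ℝ E] [SecondCountableTopology E] {y : Fin N → E}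
  {ℓ : ℝ → ℝ} {δ : ℝ}

/-- The shift is proportional to the power qs − 1 of the density, the equality case of Hölder, so
the upper bound is attained exactly. -/
theorem exists_mem_otBall_special (hconv : ConvexOn ℝ (Icc 0 1) h)
    (hcont : Tendsto h (𝓝[<] 1) (𝓝 1)) (hp : p ∈ stdSimplex ℝ (Fin N)) {q qs : ℝ} (hq : 1 < q)
    (hqs : q.HolderConjugate qs) [ENNReal.HolderConjugate (ENNReal.ofReal q) (ENNReal.ofReal qs)]
    (hnorm : h.leftDerivNorm (ENNReal.ofReal qs) ≠ ∞) {C : ℝ} (hC : 0 < C)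
    (hℓ : IsSpecialLoss C ℓ) (α : StrongDual ℝ E) (hδ : 0 ≤ δ) :
    ∃ Q ∈ otBall (fun a b : E => ‖a - b‖ ^ q) δ (discreteLaw y p),
      lossRisk h ℓ α (discreteLaw y p) +
        C * (h.leftDerivNorm (ENNReal.ofReal qs)).toReal * δ ^ (1 / q) * ‖α‖ ≤
        lossRisk h ℓ α Q := by
  obtain ⟨e, he, hαe⟩ := exists_norm_le_one_apply_eq α
  choose s hs hsl using fun i => hℓ.exists_sign hC (α (y i))
  have hqs0 : 0 < qs := hqs.symm.pos
  set κ := (h.leftDerivNorm (ENNReal.ofReal qs)).toReal with hκ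
  have hκ0 : 0 < κ := ENNReal.toReal_pos
    (leftDerivNorm_ne_zero hconv hcont (by simpa using hqs0)) hnorm
  obtain ⟨hI, hIe⟩ := integral_density_rpow hconv hqs0 hnorm
  have hqq : (qs - 1) * q = qs := hqs.symm.sub_one_mul_conj
  -- Normalization making the q-th moment of the shift equal to δ, by (qs − 1) q = qs.
  set c : ℝ := δ ^ (1 / q) * κ ^ (-(qs - 1)) with hc
  have hc0 : 0 ≤ c := by positivity
  have hG := density_nonneg hconv
  have hGq : ∀ u, h.density u * h.density u ^ (qs - 1) = h.density u ^ qs := by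
    intro u
    have := Real.rpow_add_of_nonneg (hG u) zero_le_one hqs.symm.sub_one_pos.le
    rw [Real.rpow_one, add_sub_cancel] at this
    exact this.symm
  have hGβ : ∀ u, h.density u * (C * (c * h.density u ^ (qs - 1) * ‖α‖)) =
      (C * c * ‖α‖) * h.density u ^ qs := by
    intro u; rw [← hGq]; ring
  have htδ : ∫⁻ u, ENNReal.ofReal ((c * h.density u ^ (qs - 1)) ^ q) ∂unifMeasure ≤
      ENNReal.ofReal δ := by
    have e1 : ∀ u, ENNReal.ofReal ((c * h.density u ^ (qs - 1)) ^ q) =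
        ENNReal.ofReal (c ^ q) * ENNReal.ofReal (h.density u ^ qs) := by
      intro u
      rw [Real.mul_rpow hc0 (Real.rpow_nonneg (hG u) _), ← Real.rpow_mul (hG u), hqq,
        ENNReal.ofReal_mul (by positivity)]
    simp_rw [e1]
    rw [lintegral_const_mul' _ _ ENNReal.ofReal_ne_top, lintegral_density_rpow hconv hqs0 hnorm,
      ← ENNReal.ofReal_mul (by positivity), ← hκ]
    refine ENNReal.ofReal_le_ofReal (le_of_eq ?_)
    rw [hc, Real.mul_rpow (by positivity) (by positivity), ← Real.rpow_mul hδ,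
      ← Real.rpow_mul hκ0.le, neg_mul, hqq, one_div_mul_cancel hqs.pos.ne', Real.rpow_one,
      mul_assoc, ← Real.rpow_add hκ0]
    simp
  have hβ : Integrable (fun u => h.density u * (C * (c * h.density u ^ (qs - 1) * ‖α‖)))
      unifMeasure := by
    simp_rw [hGβ]
    exact hI.const_mul _
  obtain ⟨Q, hQ, hle⟩ := exists_mem_otBall_le_lossRisk (δ := δ) hconv hcont hp hnorm hq.le hC.le
    (hℓ.abs_sub_le hC) α hδ he hαe hs (t := fun u => c * h.density u ^ (qs - 1))
    (((measurable_density hconv).pow_const _).const_mul c)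
    (fun u => mul_nonneg hc0 (Real.rpow_nonneg (hG u) _)) htδ
    (β := fun u => C * (c * h.density u ^ (qs - 1) * ‖α‖)) hβ fun i u =>
      hsl i _ (mul_nonneg (mul_nonneg hc0 (Real.rpow_nonneg (hG u) _)) (norm_nonneg _))
  refine ⟨Q, hQ, le_of_eq_of_le ?_ hle⟩
  simp_rw [hGβ]
  rw [integral_const_mul, hIe, hc]
  have : κ ^ (-(qs - 1)) * κ ^ qs = κ := by
    rw [← Real.rpow_add hκ0]
    simp
  linear_combination (-(C * δ ^ (1 / q) * ‖α‖)) * this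

theorem setIntegral_density_Ioi (hconv : ConvexOn ℝ (Icc 0 1) h)
    (hcont : Tendsto h (𝓝[<] 1) (𝓝 1)) {x : ℝ} (hx : x ∈ Icc (0 : ℝ) 1) :
    ∫ u in Ioi x, h.density u ∂unifMeasure = 1 - h x := by
  have := integral_add_compl (measurableSet_Iic (a := x)) (integrable_density hconv hcont)
  rw [compl_Iic, setIntegral_density_Iic hconv hcont hx, integral_density hconv hcont] at this
  linarith

theorem exists_mem_otBall_lipschitz (hconv : ConvexOn ℝ (Icc 0 1) h)
    (hcont : Tendsto h (𝓝[<] 1) (𝓝 1)) (hp : p ∈ stdSimplex ℝ (Fin N))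
    [ENNReal.HolderConjugate (ENNReal.ofReal 1) ∞]
    (hnorm : h.leftDerivNorm ∞ ≠ ∞) (hℓ : ConvexOn ℝ univ ℓ)
    (hlip : ∃ K : ℝ, ∀ x z, |ℓ x - ℓ z| ≤ K * |x - z|) (α : StrongDual ℝ E) (hδ : 0 ≤ δ)
    {K K₂ η : ℝ} (hK0 : 0 ≤ K) (hK : K < lipConst ℓ) (hK₂0 : 0 ≤ K₂)
    (hK₂ : K₂ < (h.leftDerivNorm ∞).toReal) (hη : 0 < η) :
    ∃ Q ∈ otBall (fun a b : E => ‖a - b‖ ^ (1 : ℝ)) δ (discreteLaw y p),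
      lossRisk h ℓ α (discreteLaw y p) + K * K₂ * δ * ‖α‖ - η ≤ lossRisk h ℓ α Q := by
  obtain ⟨e, he, hαe⟩ := exists_norm_le_one_apply_eq α
  obtain ⟨s, w₀, hs, hray⟩ := exists_ray_of_lt_lipConst hℓ hK0 hK
  obtain ⟨u₀, hu₀, hKu₀⟩ := exists_lt_density hconv hK₂0 hK₂
  set L := lipConst ℓ
  have hL0 : 0 ≤ L := lipConst_nonneg ℓ
  have hLip : ∀ x z, |ℓ x - ℓ z| ≤ L * |x - z| := abs_sub_le_lipConst hlip
  -- The growth along the ray is known only from the base point `w₀`; changing the base to any `α (y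
  -- i)` costs at most `C₀`, whatever the length of the shift.
  set C₀ := ∑ i, 2 * L * |α (y i) - w₀| with hC₀
  have hC₀0 : 0 ≤ C₀ := Finset.sum_nonneg fun i _ => by positivity
  have hG := density_nonneg hconv
  obtain ⟨x, hx, hxη⟩ : ∃ x ∈ Ioo u₀ 1, C₀ * (1 - h x) < η := by
    have h1 : Tendsto (fun x => C₀ * (1 - h x)) (𝓝[<] 1) (𝓝 0) := by
      have := (hcont.const_sub 1).const_mul C₀
      simpa using this
    have h2 : ∀ᶠ x in 𝓝[<] (1 : ℝ), x ∈ Ioo u₀ 1 := Ioo_mem_nhdsLT hu₀.2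
    exact (h2.and ((tendsto_order.1 h1).2 η hη)).exists
  have hx01 : x ∈ Icc (0 : ℝ) 1 := ⟨(hu₀.1.trans hx.1).le, hx.2.le⟩
  have hε : 0 < 1 - x := sub_pos.2 hx.2
  have hmeas : unifMeasure.real (Ioi x) = 1 - x := by
    rw [← compl_Iic, probReal_compl_eq_one_sub measurableSet_Iic, unifMeasure_real_Iic hx01]
  have hGI := integrable_density hconv hcont
  have hge : K₂ * (1 - x) ≤ 1 - h x := by
    rw [← setIntegral_density_Ioi hconv hcont hx01, ← hmeas, mul_comm, ← smul_eq_mul,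
      ← setIntegral_const]
    refine setIntegral_mono_on_ae (integrable_const _).integrableOn hGI.integrableOn
      measurableSet_Ioi ?_
    filter_upwards [ae_unifMeasure_mem] with u hu hxu
    exact hKu₀.le.trans (monotoneOn_density hconv hu₀.2 hu.2 (hx.1.trans hxu).le)
  set b := K * (δ / (1 - x) * ‖α‖) - C₀ with hb
  have hGβ : ∀ u, h.density u * (Ioi x).indicator (fun _ => b) u =
      (Ioi x).indicator (fun u => h.density u * b) u := by
    intro u
    by_cases hu : u ∈ Ioi x <;> simp [hu]
  have htδ : ∫⁻ u, ENNReal.ofReal ((Ioi x).indicator (fun _ => δ / (1 - x)) u ^ (1 : ℝ))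
      ∂unifMeasure ≤ ENNReal.ofReal δ := by
    have e1 : ∀ u, ENNReal.ofReal ((Ioi x).indicator (fun _ => δ / (1 - x)) u ^ (1 : ℝ)) =
        (Ioi x).indicator (fun _ => ENNReal.ofReal (δ / (1 - x))) u := by
      intro u
      by_cases hu : u ∈ Ioi x <;> simp [hu]
    simp_rw [e1]
    rw [lintegral_indicator measurableSet_Ioi, setLIntegral_const, ← ofReal_measureReal, hmeas,
      ← ENNReal.ofReal_mul (by positivity), div_mul_cancel₀ _ hε.ne']
  have hβ : Integrable (fun u => h.density u * (Ioi x).indicator (fun _ => b) u) unifMeasure := by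
    simp_rw [hGβ]
    exact (hGI.mul_const b).indicator measurableSet_Ioi
  have hle : ∀ i u, ℓ (α (y i)) + (Ioi x).indicator (fun _ => b) u ≤
      ℓ (α (y i) + s * ((Ioi x).indicator (fun _ => δ / (1 - x)) u * ‖α‖)) := by
    intro i u
    by_cases hu : u ∈ Ioi x
    · simp only [indicator_of_mem hu]
      set τ := δ / (1 - x) * ‖α‖ with hτ
      have hτ0 : 0 ≤ τ := by positivity
      have h1 := hray τ hτ0
      have h2 := (abs_le.1 (hLip (α (y i)) w₀)).2
      have h3 := (abs_le.1 (hLip (α (y i) + s * τ) (w₀ + s * τ))).1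
      rw [add_sub_add_right_eq_sub] at h3
      have h4 : 2 * L * |α (y i) - w₀| ≤ C₀ :=
        Finset.single_le_sum (f := fun i => 2 * L * |α (y i) - w₀|)
          (fun i _ => by positivity) (Finset.mem_univ i)
      rw [hb]
      linarith
    · simp [indicator_of_notMem hu]
  obtain ⟨Q, hQ, hQle⟩ := exists_mem_otBall_le_lossRisk (δ := δ) (q := 1) (y := y) hconv hcont hp
    hnorm le_rfl
    hL0 hLip α hδ he hαe (s := fun _ => s) (fun _ => hs)
    (t := (Ioi x).indicator fun _ => δ / (1 - x))
    (measurable_const.indicator measurableSet_Ioi)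
    (indicator_nonneg fun _ _ => by positivity) htδ (β := (Ioi x).indicator fun _ => b) hβ hle
  refine ⟨Q, hQ, le_trans ?_ hQle⟩
  simp_rw [hGβ]
  rw [integral_indicator measurableSet_Ioi, integral_mul_const,
    setIntegral_density_Ioi hconv hcont hx01]
  have h1 : K * K₂ * δ * ‖α‖ ≤ (1 - h x) * (K * (δ / (1 - x) * ‖α‖)) := by
    have := mul_le_mul_of_nonneg_right hge
      (show 0 ≤ K * (δ / (1 - x) * ‖α‖) by positivity)
    refine le_of_eq_of_le ?_ this
    field_simp
  rw [hb]
  linarith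

end Distortion

/-! ### The scalar conjugate and an exchange of infimum and supremum -/

section Conjugate

variable {q c w : ℝ}

theorem mul_rpow_conjExponent (hq : 1 < q) {X : ℝ} (hX : 0 ≤ X) :
    X * (X ^ (q / (q - 1))) ^ (1 / q) = X ^ (q / (q - 1)) := by
  have hq1 : 0 < q - 1 := sub_pos.2 hq
  have hq0 : q ≠ 0 := by linarith
  rw [← Real.rpow_mul hX]
  have e : q / (q - 1) = 1 + q / (q - 1) * (1 / q) := by field_simp; ring
  conv_rhs => rw [e, Real.rpow_add_of_nonneg hX zero_le_one (by positivity), Real.rpow_one]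

/-- Young's inequality; the last term is the maximum over δ ≥ 0 of c δ^(1/q) − w δ, attained at δ =
(c/(q w))^(q/(q−1)). -/
theorem mul_rpow_le_conjugate (hq : 1 < q) (hc : 0 ≤ c) (hw : 0 < w) {δ : ℝ} (hδ : 0 ≤ δ) :
    c * δ ^ (1 / q) ≤ w * δ + w * (q - 1) * (c / (q * w)) ^ (q / (q - 1)) := by
  have hq0 : 0 < q := by linarith
  have hq1 : 0 < q - 1 := sub_pos.2 hq
  set X := c / (q * w) with hX
  have hX0 : 0 ≤ X := by positivity
  have hconj : q.HolderConjugate (q / (q - 1)) := Real.HolderConjugate.conjExponent hq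
  have hy := Real.young_inequality_of_nonneg (a := δ ^ (1 / q)) (b := X) (by positivity) hX0 hconj
  rw [← Real.rpow_mul hδ, one_div_mul_cancel hq0.ne', Real.rpow_one] at hy
  have hcX : c = q * w * X := by rw [hX]; field_simp
  have h2 := mul_le_mul_of_nonneg_left hy (show 0 ≤ q * w by positivity)
  have h3 : q * w * (δ / q + X ^ (q / (q - 1)) / (q / (q - 1))) =
      w * δ + w * (q - 1) * X ^ (q / (q - 1)) := by field_simp
  rw [h3] at h2
  calc c * δ ^ (1 / q) = q * w * (δ ^ (1 / q) * X) := by rw [hcX]; ring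
    _ ≤ _ := h2

theorem mul_rpow_eq_conjugate (hq : 1 < q) (hc : 0 ≤ c) (hw : 0 < w) :
    c * ((c / (q * w)) ^ (q / (q - 1))) ^ (1 / q) = w * (c / (q * w)) ^ (q / (q - 1)) +
      w * (q - 1) * (c / (q * w)) ^ (q / (q - 1)) := by
  have hq0 : 0 < q := by linarith
  set X := c / (q * w) with hX
  have hX0 : 0 ≤ X := by positivity
  have hcX : c = q * w * X := by rw [hX]; field_simp
  have := mul_rpow_conjExponent hq hX0
  rw [hcX, mul_assoc, this]; ring

theorem exists_conjugate_le (hq : 1 < q) (hc : 0 < c) {ε : ℝ} (hε : 0 < ε) :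
    ∃ w, 0 < w ∧ w * (q - 1) * (c / (q * w)) ^ (q / (q - 1)) ≤ ε := by
  have hq0 : 0 < q := by linarith
  have hq1 : 0 < q - 1 := sub_pos.2 hq
  -- The conjugate term is of order w^(−1/(q−1)) and so tends to 0 for large w; `k` is chosen so
  -- that it equals ε.
  set k := ε * q / (c * (q - 1)) with hk
  have hk0 : 0 < k := by positivity
  set X := k ^ (q - 1) with hX
  have hX0 : 0 < X := by positivity
  refine ⟨c / (q * X), by positivity, le_of_eq ?_⟩
  have e1 : c / (q * (c / (q * X))) = X := by field_simp
  have e2 : X ^ (q / (q - 1)) = X * k := by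
    have e : q / (q - 1) = 1 + 1 / (q - 1) := by field_simp; ring
    rw [e, Real.rpow_add hX0, Real.rpow_one, hX, ← Real.rpow_mul hk0.le,
      mul_one_div_cancel hq1.ne', Real.rpow_one]
  rw [e1, e2, hk]
  field_simp

theorem perspective_eq (hq : 1 < q) {C a : ℝ} (hC : 0 ≤ C) (ha : 0 ≤ a) (hw : 0 < w) :
    (q ^ (1 / (1 - q)) - q ^ (q / (1 - q))) * C ^ (q / (q - 1)) * w * (w⁻¹ * a) ^ (q / (q - 1)) =
      w * (q - 1) * (C * a / (q * w)) ^ (q / (q - 1)) := by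
  have hq0 : 0 < q := by linarith
  have hq1 : 0 < q - 1 := sub_pos.2 hq
  have hq1' : (1 : ℝ) - q ≠ 0 := by linarith
  set r := q / (q - 1) with hr
  have e1 : 1 / (1 - q) = 1 - r := by rw [hr]; field_simp; ring
  have e2 : q / (1 - q) = -r := by rw [hr, ← div_neg, neg_sub]
  have e3 : (C * a / (q * w)) = q⁻¹ * (C * (w⁻¹ * a)) := by field_simp
  have hb : 0 ≤ w⁻¹ * a := by positivity
  rw [e1, e2, e3]
  generalize w⁻¹ * a = b at hb
  rw [Real.mul_rpow (by positivity) (by positivity), Real.mul_rpow hC hb,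
    Real.inv_rpow hq0.le, ← Real.rpow_neg hq0.le, sub_eq_add_neg 1 r, Real.rpow_add hq0,
    Real.rpow_one]
  ring

/-- Duality in one scalar parameter: the concave term `c * δ ^ (1 / q)` is replaced by one of its
affine majorants, uniformly over a convex set. -/
theorem exists_affine_majorant {T : Set (ℝ × ℝ)} (hT : Convex ℝ T) (hT0 : ∀ x ∈ T, 0 ≤ x.1)
    (hq : 1 < q) (hc : 0 < c) {s ε : ℝ} (hs : ∀ x ∈ T, x.2 + c * x.1 ^ (1 / q) ≤ s)
    (hε : 0 < ε) :
    ∃ w, 0 < w ∧ ∀ x ∈ T,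
      x.2 + w * x.1 + w * (q - 1) * (c / (q * w)) ^ (q / (q - 1)) ≤ s + ε := by
  have hq0 : 0 < q := by linarith
  by_cases hpos : ∃ x ∈ T, 0 < x.1
  · obtain ⟨x₀, hx₀, hx₀pos⟩ := hpos
    have h1q : 1 / q ≤ 1 := by rw [div_le_one hq0]; exact hq.le
    -- The open region above the convex curve d ↦ s − c d^(1/q); by `hs`, `T` does not meet it. A
    -- line separating the two gives the affine majorant.
    set O : Set (ℝ × ℝ) := {x | 0 < x.1 ∧ s - c * x.1 ^ (1 / q) < x.2} with hO
    have hOopen : IsOpen O := by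
      have hcn : Continuous fun x : ℝ × ℝ => x.1 ^ (1 / q) :=
        (Real.continuous_rpow_const (by positivity)).comp continuous_fst
      exact (isOpen_lt continuous_const continuous_fst).inter
        (isOpen_lt (by fun_prop) continuous_snd)
    have hOconv : Convex ℝ O := by
      rintro ⟨d, m⟩ ⟨hd, hm⟩ ⟨d', m'⟩ ⟨hd', hm'⟩ a b ha hb hab
      have hcc := (Real.concaveOn_rpow (p := 1 / q) (by positivity) h1q).2
        (x := d) (y := d') (mem_Ici.2 hd.le) (mem_Ici.2 hd'.le) ha hb hab
      simp only [smul_eq_mul] at hcc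
      simp only at hd hm hd' hm'
      have hcc' := mul_le_mul_of_nonneg_left hcc hc.le
      refine ⟨?_, ?_⟩
      · change 0 < a * d + b * d'
        rcases eq_or_lt_of_le ha with rfl | ha
        · have : b = 1 := by linarith
          rw [this]; linarith
        · have := mul_pos ha hd
          have := mul_nonneg hb hd'.le
          linarith
      · change s - c * (a * d + b * d') ^ (1 / q) < a * m + b * m'
        have h1 : a * (s - c * d ^ (1 / q)) + b * (s - c * d' ^ (1 / q)) < a * m + b * m' := by
          rcases eq_or_lt_of_le ha with rfl | ha
          · have : b = 1 := by linarith
            rw [this]; linarith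
          · have h2 := mul_lt_mul_of_pos_left hm ha
            have h3 := mul_le_mul_of_nonneg_left hm'.le hb
            linarith
        have h2 : a * (s - c * d ^ (1 / q)) + b * (s - c * d' ^ (1 / q)) =
            s - c * (a * d ^ (1 / q) + b * d' ^ (1 / q)) := by
          have : b = 1 - a := by linarith
          rw [this]; ring
        linarith
    have hdisj : Disjoint O T := by
      rw [Set.disjoint_left]
      rintro x ⟨-, hx⟩ hxT
      linarith [hs x hxT]
    obtain ⟨f, u, hfO, hfT⟩ := geometric_hahn_banach_open hOconv hOopen hT hdisj
    have hf : ∀ d m : ℝ, f (d, m) = f (1, 0) * d + f (0, 1) * m := by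
      intro d m
      have : ((d, m) : ℝ × ℝ) = d • ((1, 0) : ℝ × ℝ) + m • ((0, 1) : ℝ × ℝ) := by simp
      rw [this, map_add, map_smul, map_smul, smul_eq_mul, smul_eq_mul]; ring
    set A := f (1, 0)
    set B := f (0, 1)
    have hOmem : ∀ d m, 0 < d → s - c * d ^ (1 / q) < m → A * d + B * m < u := by
      intro d m hd hm
      rw [← hf]; exact hfO _ ⟨hd, hm⟩
    have hTmem : ∀ x ∈ T, u ≤ A * x.1 + B * x.2 := fun x hx => by
      rw [← hf]; exact hfT x hx
    -- The separating line is not vertical, because points of `O` lie above the point `x₀`, whose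
    -- radius is positive.
    have hB : B < 0 := by
      by_contra hB
      have h1 := hTmem x₀ hx₀
      have h2 := hOmem x₀.1 (|x₀.2| + |s - c * x₀.1 ^ (1 / q)| + 1) hx₀pos
        (by linarith [le_abs_self (s - c * x₀.1 ^ (1 / q)), abs_nonneg x₀.2])
      have h3 : B * x₀.2 ≤ B * (|x₀.2| + |s - c * x₀.1 ^ (1 / q)| + 1) :=
        mul_le_mul_of_nonneg_left
          (by linarith [le_abs_self x₀.2, abs_nonneg (s - c * x₀.1 ^ (1 / q))]) (not_lt.1 hB)
      linarith
    set w := A / B with hw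
    have hAw : A = w * B := by rw [hw]; field_simp [hB.ne]
    have hTle : ∀ x ∈ T, x.2 + w * x.1 ≤ u / B := by
      intro x hx
      rw [le_div_iff_of_neg hB]
      have := hTmem x hx
      rw [hAw] at this; linarith
    have hOle : ∀ d, 0 < d → u / B ≤ s - c * d ^ (1 / q) + w * d := by
      intro d hd
      refine le_of_forall_pos_le_add fun η hη => ?_
      rw [div_le_iff_of_neg hB]
      have := hOmem d (s - c * d ^ (1 / q) + η) hd (by linarith)
      rw [hAw] at this; linarith
    -- If w ≤ 0, then c d^(1/q) alone would violate `hOle` for large d; d = k^q is large enough.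
    have hwpos : 0 < w := by
      by_contra hwn
      set k := (|s - u / B| + 1) / c with hk
      have hk0 : 0 < k := by positivity
      have h1 := hOle (k ^ q) (by positivity)
      rw [← Real.rpow_mul hk0.le, mul_one_div_cancel hq0.ne', Real.rpow_one] at h1
      have h2 : c * k = |s - u / B| + 1 := by rw [hk]; field_simp
      have h3 : w * k ^ q ≤ 0 := mul_nonpos_of_nonpos_of_nonneg (not_lt.1 hwn) (by positivity)
      linarith [le_abs_self (s - u / B)]
    refine ⟨w, hwpos, fun x hx => ?_⟩
    have h1 := hTle x hx
    have h2 := hOle ((c / (q * w)) ^ (q / (q - 1))) (by positivity)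
    rw [mul_rpow_eq_conjugate hq hc.le hwpos] at h2
    linarith
  -- Every radius in `T` is zero, so the slope may be taken as large as desired; the conjugate term
  -- is then small but never zero, whence ε.
  · push Not at hpos
    obtain ⟨w, hw, hle⟩ := exists_conjugate_le hq hc hε
    refine ⟨w, hw, fun x hx => ?_⟩
    have h0 : x.1 = 0 := le_antisymm (hpos x hx) (hT0 x hx)
    have := hs x hx
    rw [h0, Real.zero_rpow (by positivity), mul_zero, add_zero] at this
    rw [h0, mul_zero]
    linarith

end Conjugate

/-! ### Robust values as values of convex programs -/

section Program

variable {N : ℕ} {h : Distortion} {V : Set ((Fin N → ℝ) × ℝ)}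

theorem convex_Vplus (hV : Convex ℝ V) : Convex ℝ (Vplus V) := by
  rintro x ⟨hx, hx0⟩ z ⟨hz, hz0⟩ a b ha hb hab
  exact ⟨hV hx hz ha hb hab, add_nonneg (mul_nonneg ha hx0) (mul_nonneg hb hz0)⟩

theorem sum_mem_Icc {p : Fin N → ℝ} (hp : p ∈ stdSimplex ℝ (Fin N)) (J : Finset (Fin N)) :
    ∑ i ∈ J, p i ∈ Icc (0 : ℝ) 1 := by
  refine ⟨Finset.sum_nonneg fun i _ => hp.1 i, ?_⟩
  rw [← hp.2]
  exact Finset.sum_le_sum_of_subset_of_nonneg (Finset.subset_univ J) fun i _ _ => hp.1 i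

theorem convex_VplusH (hV : Convex ℝ V) (hVp : ∀ x ∈ V, x.1 ∈ stdSimplex ℝ (Fin N))
    (hconv : ConvexOn ℝ (Icc 0 1) h) : Convex ℝ (VplusH h V) := by
  rintro ⟨p, d, pb⟩ ⟨hx, hsum, hnn, hJ⟩ ⟨p', d', pb'⟩ ⟨hx', hsum', hnn', hJ'⟩ a b ha hb hab
  refine ⟨convex_Vplus hV hx hx' ha hb hab, ?_, fun i => ?_, fun J => ?_⟩
  · change ∑ i, (a * pb i + b * pb' i) = 1
    simp only at hsum hsum'
    rw [Finset.sum_add_distrib, ← Finset.mul_sum, ← Finset.mul_sum, hsum, hsum']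
    linarith
  · exact add_nonneg (mul_nonneg ha (hnn i)) (mul_nonneg hb (hnn' i))
  · change h (∑ i ∈ J, (a * p i + b * p' i)) ≤ ∑ i ∈ J, (a * pb i + b * pb' i)
    simp only [Finset.sum_add_distrib, ← Finset.mul_sum]
    refine (hconv.2 (sum_mem_Icc (hVp _ hx.1) J) (sum_mem_Icc (hVp _ hx'.1) J) ha hb hab).trans ?_
    exact add_le_add (mul_le_mul_of_nonneg_left (hJ J) ha) (mul_le_mul_of_nonneg_left (hJ' J) hb)

/-- The pairing of two vectors in `ℝ^(2N+1)`, written as triples. -/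
def tripleDot (v x : (Fin N → ℝ) × ℝ × (Fin N → ℝ)) : ℝ :=
  ∑ i, v.1 i * x.1 i + v.2.1 * x.2.1 + ∑ i, v.2.2 i * x.2.2 i

theorem tripleDot_combo (v v' x : (Fin N → ℝ) × ℝ × (Fin N → ℝ)) (a b : ℝ) :
    tripleDot (a • v + b • v') x = a * tripleDot v x + b * tripleDot v' x := by
  simp only [tripleDot, Prod.fst_add, Prod.snd_add, Prod.smul_fst, Prod.smul_snd, Pi.add_apply,
    Pi.smul_apply, smul_eq_mul, add_mul, Finset.sum_add_distrib, mul_add, Finset.mul_sum, mul_assoc]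
  ring

theorem supportFn_le_coe_iff {S : Set ((Fin N → ℝ) × ℝ × (Fin N → ℝ))}
    {v : (Fin N → ℝ) × ℝ × (Fin N → ℝ)} {t : ℝ} :
    supportFn S v ≤ t ↔ ∀ x ∈ S, tripleDot v x ≤ t := by
  rw [supportFn, iSup₂_le_iff]
  exact forall₂_congr fun x _ => EReal.coe_le_coe_iff

theorem coe_tripleDot_le_supportFn {S : Set ((Fin N → ℝ) × ℝ × (Fin N → ℝ))}
    {x : (Fin N → ℝ) × ℝ × (Fin N → ℝ)} (hx : x ∈ S) (v : (Fin N → ℝ) × ℝ × (Fin N → ℝ)) :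
    ((tripleDot v x : ℝ) : EReal) ≤ supportFn S v :=
  le_iSup₂_of_le x hx le_rfl

theorem supportFn_empty (v : (Fin N → ℝ) × ℝ × (Fin N → ℝ)) :
    supportFn ∅ v = ⊥ := by simp [supportFn]

/-- All coordinates of the vectors in the set are nonnegative; this is why inequality constraints on
v suffice. -/
theorem supportFn_VplusH_mono (hVp : ∀ x ∈ V, x.1 ∈ stdSimplex ℝ (Fin N))
    {v v' : (Fin N → ℝ) × ℝ × (Fin N → ℝ)} (h1 : ∀ i, v.1 i ≤ v'.1 i) (h2 : v.2.1 ≤ v'.2.1)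
    (h3 : ∀ i, v.2.2 i ≤ v'.2.2 i) : supportFn (VplusH h V) v ≤ supportFn (VplusH h V) v' := by
  refine iSup₂_mono fun x hx => EReal.coe_le_coe_iff.2 ?_
  refine add_le_add (add_le_add (Finset.sum_le_sum fun i _ => ?_) ?_)
    (Finset.sum_le_sum fun i _ => ?_)
  · exact mul_le_mul_of_nonneg_right (h1 i) ((hVp _ hx.1.1).1 i)
  · exact mul_le_mul_of_nonneg_right h2 hx.1.2
  · exact mul_le_mul_of_nonneg_right (h3 i) (hx.2.2.1 i)

theorem convex_feasibleSet {E : Type*} [NormedAddCommGroup E] [NormedSpace ℝ E]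
    {A : Set (StrongDual ℝ E)} (hA : Convex ℝ A) (y : Fin N → E) {ℓ : ℝ → ℝ}
    (hℓ : ConvexOn ℝ univ ℓ) {κ : ℝ} (hκ : 0 ≤ κ) : Convex ℝ (feasibleSet A y ℓ κ) := by
  rintro ⟨α, v⟩ ⟨hα, hv1, hv2, hv3⟩ ⟨α', v'⟩ ⟨hα', hv1', hv2', hv3'⟩ a b ha hb hab
  refine ⟨hA hα hα' ha hb hab, fun i => ?_, ?_, fun i => ?_⟩
  · exact add_nonneg (mul_nonneg ha (hv1 i)) (mul_nonneg hb (hv1' i))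
  · change κ * ‖a • α + b • α'‖ ≤ a * v.2.1 + b * v'.2.1
    have h1 : ‖a • α + b • α'‖ ≤ a * ‖α‖ + b * ‖α'‖ := by
      refine (norm_add_le _ _).trans_eq ?_
      rw [norm_smul, norm_smul, Real.norm_of_nonneg ha, Real.norm_of_nonneg hb]
    have h2 := mul_le_mul_of_nonneg_left h1 hκ
    have h3 := mul_le_mul_of_nonneg_left hv2 ha
    have h4 := mul_le_mul_of_nonneg_left hv2' hb
    simp only at h3 h4
    linarith
  · change ℓ (a * α (y i) + b * α' (y i)) ≤ a * v.2.2 i + b * v'.2.2 i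
    exact (hℓ.2 (mem_univ _) (mem_univ _) ha hb hab).trans
      (add_le_add (mul_le_mul_of_nonneg_left (hv3 i) ha) (mul_le_mul_of_nonneg_left (hv3' i) hb))

theorem iInf_eq_iInf_program {F W : Type*} {A : Set F} {f : F → EReal} {S : Set (F × W)}
    {obj : F × W → EReal} (hS : ∀ z ∈ S, z.1 ∈ A)
    (hf : ∀ α ∈ A, f α = ⨅ v ∈ {v : W | (α, v) ∈ S}, obj (α, v)) :
    (⨅ α ∈ A, f α) = ⨅ z ∈ S, obj z := by
  refine le_antisymm (le_iInf₂ fun z hz => ?_) (le_iInf₂ fun α hα => ?_)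
  · refine (iInf₂_le z.1 (hS z hz)).trans ?_
    rw [hf _ (hS z hz)]
    exact iInf₂_le z.2 hz
  · rw [hf α hα]
    exact le_iInf₂ fun v hv => iInf₂_le (α, v) hv

variable {E : Type*} [NormedAddCommGroup E] [NormedSpace ℝ E] {y : Fin N → E} {ℓ : ℝ → ℝ}

theorem isConvexProgram_supportFn {A : Set (StrongDual ℝ E)} (hA : Convex ℝ A)
    (hℓ : ConvexOn ℝ univ ℓ) {κ : ℝ} (hκ : 0 ≤ κ)
    (S : Set ((Fin N → ℝ) × ℝ × (Fin N → ℝ))) :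
    IsConvexProgram (feasibleSet A y ℓ κ) (fun z => supportFn S z.2) := by
  have hS := convex_feasibleSet hA y hℓ hκ
  refine ⟨hS, ?_⟩
  rintro ⟨z, t⟩ ⟨hz, ht⟩ ⟨z', t'⟩ ⟨hz', ht'⟩ a b ha hb hab
  refine ⟨hS hz hz' ha hb hab, ?_⟩
  rw [supportFn_le_coe_iff] at ht ht'
  refine supportFn_le_coe_iff.2 fun x hx => ?_
  change tripleDot (a • z.2 + b • z'.2) x ≤ a * t + b * t'
  rw [tripleDot_combo]
  exact add_le_add (mul_le_mul_of_nonneg_left (ht x hx) ha)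
    (mul_le_mul_of_nonneg_left (ht' x hx) hb)

section Power

variable {q C : ℝ}

theorem perspTerm_of_pos {F : Type*} [NormedAddCommGroup F] [NormedSpace ℝ F] (hq : 1 < q)
    (hC : 0 ≤ C) {w : ℝ} (hw : 0 < w) (a : F) :
    perspTerm ((q ^ (1 / (1 - q)) - q ^ (q / (1 - q))) * C ^ (q / (q - 1))) (q / (q - 1)) w a =
      ((w * (q - 1) * (C * ‖a‖ / (q * w)) ^ (q / (q - 1)) : ℝ) : EReal) := by
  rw [perspTerm, if_neg hw.ne', norm_smul, norm_inv, Real.norm_of_nonneg hw.le,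
    perspective_eq hq hC (norm_nonneg a) hw]

/-- The objective of the program is a supremum of convex functions. -/
theorem supportFn_add_perspTerm_le_coe_iff {F : Type*} [NormedAddCommGroup F] [NormedSpace ℝ F]
    (hq : 1 < q) (hC : 0 < C) {S : Set ((Fin N → ℝ) × ℝ × (Fin N → ℝ))}
    {v : (Fin N → ℝ) × ℝ × (Fin N → ℝ)} (hv : 0 ≤ v.2.1) (a : F) {t : ℝ} :
    supportFn S v + perspTerm ((q ^ (1 / (1 - q)) - q ^ (q / (1 - q))) * C ^ (q / (q - 1)))
        (q / (q - 1)) v.2.1 a ≤ t ↔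
      ∀ x ∈ S, ∀ d : ℝ, 0 ≤ d → tripleDot v x + (C * ‖a‖ * d ^ (1 / q) - v.2.1 * d) ≤ t := by
  have hq0 : 0 < q := by linarith
  have hq1 : 0 < q - 1 := sub_pos.2 hq
  -- For empty `S` the support function is `⊥`, which in `EReal` absorbs even the value `⊤` of the
  -- perspective term.
  rcases S.eq_empty_or_nonempty with rfl | ⟨x₀, hx₀⟩
  · simp [supportFn_empty]
  have hbot : supportFn S v ≠ ⊥ := fun hb => by
    have := coe_tripleDot_le_supportFn hx₀ v
    rw [hb, le_bot_iff] at this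
    exact EReal.coe_ne_bot _ this
  rcases eq_or_lt_of_le hv with hv0 | hvpos
  · by_cases ha : a = 0
    · rw [perspTerm, if_pos hv0.symm, if_pos ha, add_zero, supportFn_le_coe_iff, ← hv0, ha]
      simp only [norm_zero, mul_zero, zero_mul, sub_zero, add_zero]
      exact ⟨fun h x hx _ _ => h x hx, fun h x hx => h x hx 0 le_rfl⟩
    · rw [perspTerm, if_pos hv0.symm, if_neg ha, EReal.add_top_of_ne_bot hbot, ← hv0]
      have hpos : 0 < C * ‖a‖ := mul_pos hC (norm_pos_iff.2 ha)
      refine ⟨fun h => absurd h (not_le.2 (EReal.coe_lt_top t)), fun h => ?_⟩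
      exfalso
      -- Without the linear term in d the power is unbounded; at d = k^q it exceeds the gap to t.
      set k := (|t - tripleDot v x₀| + 1) / (C * ‖a‖) with hk
      have hk0 : 0 < k := by positivity
      have h1 := h x₀ hx₀ (k ^ q) (by positivity)
      rw [← Real.rpow_mul hk0.le, mul_one_div_cancel hq0.ne', Real.rpow_one] at h1
      have h2 : C * ‖a‖ * k = |t - tripleDot v x₀| + 1 := by
        rw [hk]; exact mul_div_cancel₀ _ hpos.ne'
      rw [h2] at h1
      linarith [le_abs_self (t - tripleDot v x₀)]
  · have hc : 0 ≤ C * ‖a‖ := by positivity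
    rw [perspTerm_of_pos hq hC.le hvpos]
    set ψ := v.2.1 * (q - 1) * (C * ‖a‖ / (q * v.2.1)) ^ (q / (q - 1)) with hψ
    constructor
    · intro h x hx d hd
      have h1 := (add_le_add_left (coe_tripleDot_le_supportFn hx v) (ψ : EReal)).trans h
      rw [← EReal.coe_add, EReal.coe_le_coe_iff] at h1
      have h2 := mul_rpow_le_conjugate hq hc hvpos hd
      linarith
    · intro h
      have h1 : supportFn S v ≤ ((t - ψ : ℝ) : EReal) := by
        refine supportFn_le_coe_iff.2 fun x hx => ?_
        have h2 := h x hx ((C * ‖a‖ / (q * v.2.1)) ^ (q / (q - 1))) (by positivity)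
        rw [mul_rpow_eq_conjugate hq hc hvpos] at h2
        linarith
      refine (add_le_add_left h1 (ψ : EReal)).trans ?_
      rw [← EReal.coe_add, sub_add_cancel]

/-- For each fixed x and d the bound in `supportFn_add_perspTerm_le_coe_iff` is jointly convex in
(α, v), so no case distinction on whether v_{N+1} vanishes is needed. -/
theorem isConvexProgram_supportFn_add_perspTerm (hq : 1 < q) (hC : 0 < C)
    {A : Set (StrongDual ℝ E)} (hA : Convex ℝ A) (hℓ : ConvexOn ℝ univ ℓ)
    (S : Set ((Fin N → ℝ) × ℝ × (Fin N → ℝ))) :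
    IsConvexProgram (feasibleSet A y ℓ 0) (fun z => supportFn S z.2 +
      perspTerm ((q ^ (1 / (1 - q)) - q ^ (q / (1 - q))) * C ^ (q / (q - 1)))
        (q / (q - 1)) z.2.2.1 z.1) := by
  have hS := convex_feasibleSet hA y hℓ le_rfl
  refine ⟨hS, ?_⟩
  have hw : ∀ z ∈ feasibleSet A y ℓ 0, 0 ≤ z.2.2.1 := fun z hz => by
    have := hz.2.2.1
    rwa [zero_mul] at this
  rintro ⟨z, t⟩ ⟨hz, ht⟩ ⟨z', t'⟩ ⟨hz', ht'⟩ a b ha hb hab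
  have hzz := hS hz hz' ha hb hab
  refine ⟨hzz, ?_⟩
  simp only at ht ht'
  rw [supportFn_add_perspTerm_le_coe_iff hq hC (hw _ hz)] at ht
  rw [supportFn_add_perspTerm_le_coe_iff hq hC (hw _ hz')] at ht'
  refine (supportFn_add_perspTerm_le_coe_iff hq hC (hw _ hzz) _).2 fun x hx d hd => ?_
  change tripleDot (a • z.2 + b • z'.2) x + (C * ‖a • z.1 + b • z'.1‖ * d ^ (1 / q) -
    (a * z.2.2.1 + b * z'.2.2.1) * d) ≤ a * t + b * t'
  rw [tripleDot_combo]
  have h1 : ‖a • z.1 + b • z'.1‖ ≤ a * ‖z.1‖ + b * ‖z'.1‖ := by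
    refine (norm_add_le _ _).trans_eq ?_
    rw [norm_smul, norm_smul, Real.norm_of_nonneg ha, Real.norm_of_nonneg hb]
  have h2 := mul_le_mul_of_nonneg_right (mul_le_mul_of_nonneg_left h1 hC.le)
    (Real.rpow_nonneg hd (1 / q))
  have h3 := mul_le_mul_of_nonneg_left (ht x hx d hd) ha
  have h4 := mul_le_mul_of_nonneg_left (ht' x hx d hd) hb
  linarith

end Power

variable [MeasurableSpace E]

/-- Balls of negative radius are empty, so `V` may be replaced by `Vplus V`. The slack η is there
because the bound need not be attained when q = 1. -/
theorem worstCase_eq_robustValue {D : E → E → ℝ} (r : ℝ → ℝ) (α : StrongDual ℝ E)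
    (hU : ∀ x ∈ V, ∀ Q ∈ otBall D x.2 (discreteLaw y x.1),
      lossRisk h ℓ α Q ≤ lossRisk h ℓ α (discreteLaw y x.1) + r x.2 * ‖α‖)
    (hL : ∀ x ∈ Vplus V, ∀ η : ℝ, 0 < η → ∃ Q ∈ otBall D x.2 (discreteLaw y x.1),
      lossRisk h ℓ α (discreteLaw y x.1) + r x.2 * ‖α‖ - η ≤ lossRisk h ℓ α Q) :
    worstCase D y V h ℓ α = robustValue y V h ℓ r α := by
  refine le_antisymm (iSup₂_le fun Q hQ => ?_) (iSup₂_le fun x hx => ?_)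
  · rw [unionBall, mem_iUnion₂] at hQ
    obtain ⟨x, hx, hQ⟩ := hQ
    exact le_iSup₂_of_le x ⟨hx, nonneg_of_mem_otBall hQ⟩ (EReal.coe_le_coe_iff.2 (hU x hx Q hQ))
  · by_contra hlt
    obtain ⟨t, ht1, ht2⟩ := EReal.lt_iff_exists_real_btwn.1 (not_le.1 hlt)
    have ht2' := EReal.coe_lt_coe_iff.1 ht2
    obtain ⟨Q, hQ, hle⟩ := hL x hx _ (sub_pos.2 ht2')
    rw [sub_sub_cancel] at hle
    have hmem : Q ∈ unionBall D y V := mem_iUnion₂.2 ⟨x, hx.1, hQ⟩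
    have : ((lossRisk h ℓ α Q : ℝ) : EReal) ≤ worstCase D y V h ℓ α := le_iSup₂_of_le Q hmem le_rfl
    exact absurd ((EReal.coe_le_coe_iff.2 hle).trans this) (not_le.2 ht1)

variable [BorelSpace E]

theorem robustValue_eq_iSup (hVp : ∀ x ∈ V, x.1 ∈ stdSimplex ℝ (Fin N))
    (hconv : ConvexOn ℝ (Icc 0 1) h) (hcont : Tendsto h (𝓝[<] 1) (𝓝 1)) (hℓ : Continuous ℓ)
    (r : ℝ → ℝ) (α : StrongDual ℝ E) :
    robustValue y V h ℓ r α = ⨆ x ∈ VplusH h V,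
      ((∑ i, ℓ (α (y i)) * x.2.2 i + r x.2.1 * ‖α‖ : ℝ) : EReal) := by
  refine le_antisymm (iSup₂_le fun x hx => ?_) (iSup₂_le fun x hx => ?_)
  · obtain ⟨pb, hpb, heq⟩ := Distortion.exists_mem_riskEnvelope hconv hcont (hVp x hx.1)
      fun i => ℓ (α (y i))
    refine le_iSup₂_of_le (x.1, x.2, pb) ⟨hx, hpb⟩ (EReal.coe_le_coe_iff.2 ?_)
    rw [Distortion.lossRisk_discreteLaw hℓ, ← heq]
    simp_rw [mul_comm (pb _)]
    exact le_rfl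
  · refine le_iSup₂_of_le (x.1, x.2.1) hx.1 (EReal.coe_le_coe_iff.2 ?_)
    rw [Distortion.lossRisk_discreteLaw hℓ]
    have := Distortion.sum_mul_le_risk hconv hcont (hVp _ hx.1.1) (fun i => ℓ (α (y i))) hx.2
    simp_rw [mul_comm _ (x.2.2 _)]
    linarith

theorem tripleDot_zero_left (w : ℝ) (z : Fin N → ℝ) (x : (Fin N → ℝ) × ℝ × (Fin N → ℝ)) :
    tripleDot (0, w, z) x = ∑ i, z i * x.2.2 i + w * x.2.1 := by
  simp [tripleDot, add_comm]

theorem robustValue_linear_eq_iInf (hVp : ∀ x ∈ V, x.1 ∈ stdSimplex ℝ (Fin N))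
    (hconv : ConvexOn ℝ (Icc 0 1) h) (hcont : Tendsto h (𝓝[<] 1) (𝓝 1)) (hℓ : Continuous ℓ)
    (κ : ℝ) {A : Set (StrongDual ℝ E)} {α : StrongDual ℝ E} (hα : α ∈ A) :
    robustValue y V h ℓ (fun δ => κ * δ) α =
      ⨅ v ∈ {v | (α, v) ∈ feasibleSet A y ℓ κ}, supportFn (VplusH h V) v := by
  have heq : robustValue y V h ℓ (fun δ => κ * δ) α =
      supportFn (VplusH h V) (0, κ * ‖α‖, fun i => ℓ (α (y i))) := by
    rw [robustValue_eq_iSup hVp hconv hcont hℓ]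
    refine iSup_congr fun x => iSup_congr fun _ => ?_
    have := tripleDot_zero_left (κ * ‖α‖) (fun i => ℓ (α (y i))) x
    rw [tripleDot] at this
    rw [this]
    congr 2
    ring
  rw [heq]
  refine le_antisymm (le_iInf₂ fun v hv => ?_) (iInf₂_le _ ?_)
  · exact supportFn_VplusH_mono hVp (fun i => hv.2.1 i) hv.2.2.1 hv.2.2.2
  · exact ⟨hα, fun i => le_rfl, le_rfl, fun i => le_rfl⟩

/-- One inequality is weak duality, valid for each feasible v. For the other, any t above the robust
value is reached by v = (0, w, losses) with w from the separation argument. -/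
theorem robustValue_power_eq_iInf (hV : Convex ℝ V)
    (hVp : ∀ x ∈ V, x.1 ∈ stdSimplex ℝ (Fin N)) (hconv : ConvexOn ℝ (Icc 0 1) h)
    (hcont : Tendsto h (𝓝[<] 1) (𝓝 1)) (hℓ : Continuous ℓ) {q C : ℝ} (hq : 1 < q)
    (hC : 0 < C) {A : Set (StrongDual ℝ E)} {α : StrongDual ℝ E} (hα : α ∈ A) :
    robustValue y V h ℓ (fun δ => C * δ ^ (1 / q)) α =
      ⨅ v ∈ {v | (α, v) ∈ feasibleSet A y ℓ 0}, (supportFn (VplusH h V) v +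
        perspTerm ((q ^ (1 / (1 - q)) - q ^ (q / (1 - q))) * C ^ (q / (q - 1)))
          (q / (q - 1)) v.2.1 α) := by
  have hq0 : 0 < q := by linarith
  have hmem : ∀ w : ℝ, 0 ≤ w → (0, w, fun i => ℓ (α (y i))) ∈
      {v : (Fin N → ℝ) × ℝ × (Fin N → ℝ) | (α, v) ∈ feasibleSet A y ℓ 0} := fun w hw =>
    ⟨hα, fun i => le_rfl, by simpa using hw, fun i => le_rfl⟩
  rw [robustValue_eq_iSup hVp hconv hcont hℓ]
  refine le_antisymm (le_iInf₂ fun v hv => iSup₂_le fun x hx => ?_) ?_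
  · have hv0 : 0 ≤ v.2.1 := by simpa using hv.2.2.1
    refine EReal.le_of_forall_lt_iff_le.1 fun t ht => ?_
    have h1 := (supportFn_add_perspTerm_le_coe_iff hq hC hv0 α).1 ht.le x hx x.2.1 hx.1.2
    refine EReal.coe_le_coe_iff.2 (le_trans ?_ h1)
    have h2 : ∑ i, ℓ (α (y i)) * x.2.2 i ≤ ∑ i, v.2.2 i * x.2.2 i :=
      Finset.sum_le_sum fun i _ => mul_le_mul_of_nonneg_right (hv.2.2.2 i) (hx.2.2.1 i)
    have h3 : 0 ≤ ∑ i, v.1 i * x.1 i :=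
      Finset.sum_nonneg fun i _ => mul_nonneg (hv.2.1 i) ((hVp _ hx.1.1).1 i)
    rw [tripleDot]
    linarith
  · refine EReal.le_of_forall_lt_iff_le.1 fun t ht => ?_
    have hbound : ∀ x ∈ VplusH h V,
        ((∑ i, ℓ (α (y i)) * x.2.2 i + C * x.2.1 ^ (1 / q) * ‖α‖ : ℝ) : EReal) ≤
          ⨆ x ∈ VplusH h V,
            ((∑ i, ℓ (α (y i)) * x.2.2 i + C * x.2.1 ^ (1 / q) * ‖α‖ : ℝ) : EReal) :=
      fun x hx => le_iSup₂_of_le x hx le_rfl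
    -- For α = 0 the choice w = 0 is optimal and the perspective term vanishes; the separation
    -- argument needs a positive coefficient.
    by_cases hα0 : α = 0
    · refine (iInf₂_le _ (hmem 0 le_rfl)).trans ?_
      rw [supportFn_add_perspTerm_le_coe_iff hq hC le_rfl]
      intro x hx d hd
      have := EReal.coe_lt_coe_iff.1 ((hbound x hx).trans_lt ht)
      rw [tripleDot_zero_left]
      simp only [hα0, norm_zero, mul_zero, zero_mul, add_zero, sub_zero] at this ⊢
      exact this.le
    · obtain ⟨s, hs1, hs2⟩ := EReal.lt_iff_exists_real_btwn.1 ht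
      have hst := EReal.coe_lt_coe_iff.1 hs2
      -- Only the radius and the reweighted loss matter, so duality takes place in the planar linear
      -- image, convex because `VplusH h V` is.
      set T : Set (ℝ × ℝ) :=
        (fun x : (Fin N → ℝ) × ℝ × (Fin N → ℝ) => (x.2.1, ∑ i, ℓ (α (y i)) * x.2.2 i)) ''
          VplusH h V with hT
      have hTconv : Convex ℝ T := by
        refine (convex_VplusH hV hVp hconv).is_linear_image ⟨fun x z => ?_, fun a x => ?_⟩
        · simp [mul_add, Finset.sum_add_distrib]
        · simp [Finset.mul_sum, mul_left_comm]
      obtain ⟨w, hw, hle⟩ := exists_affine_majorant (c := C * ‖α‖) (s := s) (ε := t - s) hTconv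
        (by rintro _ ⟨x, hx, rfl⟩; exact hx.1.2) hq (mul_pos hC (norm_pos_iff.2 hα0))
        (by
          rintro _ ⟨x, hx, rfl⟩
          have := EReal.coe_lt_coe_iff.1 ((hbound x hx).trans_lt hs1)
          simp only
          linarith) (sub_pos.2 hst)
      refine (iInf₂_le _ (hmem w hw.le)).trans ?_
      rw [supportFn_add_perspTerm_le_coe_iff hq hC hw.le]
      intro x hx d hd
      have h1 := hle _ ⟨x, hx, rfl⟩
      have h2 := mul_rpow_le_conjugate hq (mul_pos hC (norm_pos_iff.2 hα0)).le hw hd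
      rw [tripleDot_zero_left]
      simp only at h1 ⊢
      linarith

end Program

/-! ### Worst-case values over the union of balls -/

section WorstCase

variable {E : Type*} [NormedAddCommGroup E] [NormedSpace ℝ E]
  [MeasurableSpace E] [BorelSpace E] [SecondCountableTopology E] {N : ℕ} {y : Fin N → E}
  {V : Set ((Fin N → ℝ) × ℝ)} {h : Distortion} {ℓ : ℝ → ℝ}

theorem integrable_of_mem_unionBall (hVp : ∀ x ∈ V, x.1 ∈ stdSimplex ℝ (Fin N))
    (hconv : ConvexOn ℝ (Icc 0 1) h) (hcont : Tendsto h (𝓝[<] 1) (𝓝 1)) {q L : ℝ} {qs : ℝ≥0∞}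
    [ENNReal.HolderConjugate (ENNReal.ofReal q) qs] (hnorm : h.leftDerivNorm qs ≠ ∞)
    (hq : 1 ≤ q) (hL : 0 ≤ L) (hℓ : ∀ x z, |ℓ x - ℓ z| ≤ L * |x - z|) (α : StrongDual ℝ E)
    {Q : Measure E} (hQ : Q ∈ unionBall (fun a b : E => ‖a - b‖ ^ q) y V) :
    Integrable (fun z : ℝ => z) (h.distortedLaw (Q.map (fun y => ℓ (α y)))) := by
  obtain ⟨x, hx, hQx⟩ := mem_iUnion₂.1 hQ
  exact (Distortion.lossRisk_le_of_mem_otBall hconv hcont (hVp x hx) hnorm hq hL hℓ α hQx).1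

variable [FiniteDimensional ℝ E]

theorem worstCase_lipschitz_eq (hVp : ∀ x ∈ V, x.1 ∈ stdSimplex ℝ (Fin N))
    (hconv : ConvexOn ℝ (Icc 0 1) h) (hcont : Tendsto h (𝓝[<] 1) (𝓝 1))
    [ENNReal.HolderConjugate (ENNReal.ofReal 1) ∞] (hnorm : h.leftDerivNorm ∞ ≠ ∞)
    (hℓ : ConvexOn ℝ univ ℓ) (hlip : ∃ K : ℝ, ∀ x z, |ℓ x - ℓ z| ≤ K * |x - z|)
    (α : StrongDual ℝ E) :
    worstCase (fun a b : E => ‖a - b‖ ^ (1 : ℝ)) y V h ℓ α =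
      robustValue y V h ℓ (fun δ => lipConst ℓ * (h.leftDerivNorm ∞).toReal * δ) α := by
  set κ := (h.leftDerivNorm ∞).toReal with hκ
  have hκ0 : 0 < κ := ENNReal.toReal_pos
    (Distortion.leftDerivNorm_ne_zero hconv hcont (by simp)) hnorm
  refine worstCase_eq_robustValue _ α (fun x hx Q hQ => ?_) fun x hx η hη => ?_
  · have := (Distortion.lossRisk_le_of_mem_otBall hconv hcont (hVp x hx) hnorm le_rfl
      (lipConst_nonneg ℓ) (abs_sub_le_lipConst hlip) α hQ).2
    simpa using this
  -- A constant loss has no slope strictly between 0 and its Lipschitz constant; the unshifted law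
  -- serves instead.
  · rcases eq_or_lt_of_le (lipConst_nonneg ℓ) with hL0 | hL0
    · obtain ⟨e, he, hαe⟩ := exists_norm_le_one_apply_eq α
      obtain ⟨Q, hQ, hle⟩ := Distortion.exists_mem_otBall_le_lossRisk (q := 1) (qs := ∞) (y := y)
        (s := fun _ => 1) (t := 0) (β := 0) hconv hcont (hVp x hx.1) hnorm le_rfl
        (lipConst_nonneg ℓ) (abs_sub_le_lipConst hlip) α hx.2 he hαe (by simp)
        measurable_zero (by simp) (by simp) (by simp) (by simp)
      refine ⟨Q, hQ, le_trans ?_ hle⟩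
      simp only [← hL0, Pi.zero_apply, mul_zero, zero_mul, integral_zero, add_zero]
      linarith
    · set M := lipConst ℓ * κ * x.2 * ‖α‖ with hM
      have hM0 : 0 ≤ M := mul_nonneg (mul_nonneg (mul_pos hL0 hκ0).le hx.2) (norm_nonneg α)
      -- Both the slope and the density level are reduced by the factor 1 − τ; the loss in the
      -- product is at most 2τM ≤ η/2, and the other η/2 is left for the shift of base point.
      set τ := min (1 / 2) (η / (4 * (M + 1))) with hτ
      have hτ0 : 0 < τ := lt_min (by norm_num) (by positivity)
      have hτ1 : τ ≤ 1 / 2 := min_le_left _ _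
      have hτM : 4 * τ * M ≤ η := by
        have h1 : τ * (4 * (M + 1)) ≤ η := (le_div_iff₀ (by positivity)).1 (min_le_right _ _)
        linarith
      obtain ⟨Q, hQ, hle⟩ := Distortion.exists_mem_otBall_lipschitz (y := y) (δ := x.2) hconv hcont
        (hVp x hx.1) hnorm hℓ hlip α hx.2 (K := lipConst ℓ * (1 - τ)) (K₂ := κ * (1 - τ))
        (η := η / 2) (mul_nonneg hL0.le (by linarith)) (mul_lt_of_lt_one_right hL0 (by linarith))
        (mul_nonneg hκ0.le (by linarith)) (mul_lt_of_lt_one_right hκ0 (by linarith))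
        (by linarith)
      refine ⟨Q, hQ, le_trans ?_ hle⟩
      have e1 : lipConst ℓ * (1 - τ) * (κ * (1 - τ)) * x.2 * ‖α‖ = M - 2 * τ * M + τ ^ 2 * M := by
        rw [hM]; ring
      have e2 : 0 ≤ τ ^ 2 * M := by positivity
      rw [e1]
      linarith

theorem worstCase_special_eq (hVp : ∀ x ∈ V, x.1 ∈ stdSimplex ℝ (Fin N))
    (hconv : ConvexOn ℝ (Icc 0 1) h) (hcont : Tendsto h (𝓝[<] 1) (𝓝 1)) {q qs C : ℝ}
    (hqs : q.HolderConjugate qs) (hnorm : h.leftDerivNorm (ENNReal.ofReal qs) ≠ ∞) (hC : 0 < C)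
    (hℓ : IsSpecialLoss C ℓ) (α : StrongDual ℝ E) :
    worstCase (fun a b : E => ‖a - b‖ ^ q) y V h ℓ α =
      robustValue y V h ℓ
        (fun δ => C * (h.leftDerivNorm (ENNReal.ofReal qs)).toReal * δ ^ (1 / q)) α := by
  have := hqs.ennrealOfReal
  refine worstCase_eq_robustValue _ α (fun x hx Q hQ => ?_) fun x hx η hη => ?_
  · exact (Distortion.lossRisk_le_of_mem_otBall hconv hcont (hVp x hx) hnorm hqs.lt.le
      hC.le (hℓ.abs_sub_le hC) α hQ).2
  · obtain ⟨Q, hQ, hle⟩ := Distortion.exists_mem_otBall_special (y := y) (δ := x.2) hconv hcont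
      (hVp x hx.1) hqs.lt hqs hnorm hC hℓ α hx.2
    exact ⟨Q, hQ, by linarith⟩

end WorstCase

end

theorem mainTheorem3
    {E : Type*} [NormedAddCommGroup E] [NormedSpace ℝ E] [FiniteDimensional ℝ E]
    [MeasurableSpace E] [BorelSpace E]
    {N : ℕ} (y : Fin N → E)
    (V : Set ((Fin N → ℝ) × ℝ)) (hV : Convex ℝ V)
    (hVp : ∀ x ∈ V, x.1 ∈ stdSimplex ℝ (Fin N))
    (A : Set (StrongDual ℝ E))
    (h : Distortion) (hconv : ConvexOn ℝ (Icc 0 1) h)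
    (hcont : Tendsto h (𝓝[<] 1) (𝓝 1)) :
    -- (i) transport cost given by the norm, convex Lipschitz loss
    (∀ ℓ : ℝ → ℝ, ConvexOn ℝ univ ℓ →
      (∃ K : ℝ, ∀ x z, |ℓ x - ℓ z| ≤ K * |x - z|) →
      h.leftDerivNorm ∞ ≠ ∞ →
      (∀ α ∈ A, ∀ Q ∈ unionBall (fun y₁ y₂ : E => ‖y₁ - y₂‖) y V,
        Integrable (fun z : ℝ => z) (h.distortedLaw (Q.map (fun y => ℓ (α y))))) ∧
      EquivalentProblems A
        (worstCase (fun y₁ y₂ : E => ‖y₁ - y₂‖) y V h ℓ)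
        (robustValue y V h ℓ (fun δ => lipConst ℓ * (h.leftDerivNorm ∞).toReal * δ)) ∧
      SolvedByConvexProgram A
        (worstCase (fun y₁ y₂ : E => ‖y₁ - y₂‖) y V h ℓ)
        (feasibleSet A y ℓ (lipConst ℓ * (h.leftDerivNorm ∞).toReal))
        (fun z => supportFn (VplusH h V) z.2)) ∧
    -- (ii) transport cost given by the `q`-th power of the norm, special losses
    (∀ q qs : ℝ, 1 < q → 1 / q + 1 / qs = 1 →
      ∀ (C : ℝ) (ℓ : ℝ → ℝ), 0 < C → IsSpecialLoss C ℓ →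
      h.leftDerivNorm (ENNReal.ofReal qs) ≠ ∞ →
      (∀ α ∈ A, ∀ Q ∈ unionBall (fun y₁ y₂ : E => ‖y₁ - y₂‖ ^ q) y V,
        Integrable (fun z : ℝ => z) (h.distortedLaw (Q.map (fun y => ℓ (α y))))) ∧
      EquivalentProblems A
        (worstCase (fun y₁ y₂ : E => ‖y₁ - y₂‖ ^ q) y V h ℓ)
        (robustValue y V h ℓ
          (fun δ => C * (h.leftDerivNorm (ENNReal.ofReal qs)).toReal * δ ^ (1 / q))) ∧
      SolvedByConvexProgram A
        (worstCase (fun y₁ y₂ : E => ‖y₁ - y₂‖ ^ q) y V h ℓ)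
        (feasibleSet A y ℓ 0)
        (fun z => supportFn (VplusH h V) z.2 +
          perspTerm
            ((q ^ (1 / (1 - q)) - q ^ (q / (1 - q))) *
              (C * (h.leftDerivNorm (ENNReal.ofReal qs)).toReal) ^ (q / (q - 1)))
            (q / (q - 1)) z.2.2.1 z.1)) := by
  -- Properness supplies the second countability that the measurability of differences in E
  -- requires.
  have := FiniteDimensional.proper_real E
  refine ⟨fun ℓ hℓ hlip hnorm => ?_, fun q qs hq hqqs C ℓ hC hℓ hnorm => ?_⟩
  · have hcost : (fun y₁ y₂ : E => ‖y₁ - y₂‖) = fun y₁ y₂ : E => ‖y₁ - y₂‖ ^ (1 : ℝ) := by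
      simp only [Real.rpow_one]
    have hone : ENNReal.HolderConjugate (ENNReal.ofReal 1) ∞ := by
      rw [ENNReal.ofReal_one]; infer_instance
    have hlip' := abs_sub_le_lipConst hlip
    have heq := worstCase_lipschitz_eq (y := y) hVp hconv hcont hnorm hℓ hlip
    rw [hcost]
    have hinf : ∀ α ∈ A, worstCase (fun y₁ y₂ : E => ‖y₁ - y₂‖ ^ (1 : ℝ)) y V h ℓ α = _ :=
      fun α hα => (heq α).trans (robustValue_linear_eq_iInf hVp hconv hcont
        (continuous_of_abs_sub_le hlip') (lipConst ℓ * (h.leftDerivNorm ∞).toReal) hα)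
    refine ⟨fun α _ Q hQ => integrable_of_mem_unionBall hVp hconv hcont hnorm le_rfl
      (lipConst_nonneg ℓ) hlip' α hQ, ⟨fun α _ => heq α, by simp only [heq]⟩,
      hinf, iInf_eq_iInf_program (obj := fun z => supportFn (VplusH h V) z.2)
        (fun z hz => hz.1) hinf, fun hA => ?_⟩
    exact isConvexProgram_supportFn hA hℓ
      (mul_nonneg (lipConst_nonneg ℓ) ENNReal.toReal_nonneg) _
  · have hqs : q.HolderConjugate qs := Real.holderConjugate_iff.2
      ⟨hq, by rwa [one_div, one_div] at hqqs⟩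
    have hconj := hqs.ennrealOfReal
    have hlip := hℓ.abs_sub_le hC
    have hκ : 0 < C * (h.leftDerivNorm (ENNReal.ofReal qs)).toReal :=
      mul_pos hC (ENNReal.toReal_pos (Distortion.leftDerivNorm_ne_zero hconv hcont
        (by simpa using hqs.symm.pos)) hnorm)
    have heq := worstCase_special_eq (y := y) hVp hconv hcont hqs hnorm hC hℓ
    have hinf : ∀ α ∈ A, worstCase (fun y₁ y₂ : E => ‖y₁ - y₂‖ ^ q) y V h ℓ α = _ :=
      fun α hα => (heq α).trans (robustValue_power_eq_iInf hV hVp hconv hcont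
        (continuous_of_abs_sub_le hlip) hq hκ hα)
    refine ⟨fun α _ Q hQ => integrable_of_mem_unionBall hVp hconv hcont hnorm hq.le hC.le hlip α hQ,
      ⟨fun α _ => heq α, by simp only [heq]⟩, hinf, iInf_eq_iInf_program
        (obj := fun z => supportFn (VplusH h V) z.2 + perspTerm
          ((q ^ (1 / (1 - q)) - q ^ (q / (1 - q))) *
            (C * (h.leftDerivNorm (ENNReal.ofReal qs)).toReal) ^ (q / (q - 1)))
          (q / (q - 1)) z.2.2.1 z.1) (fun z hz => hz.1) hinf, fun hA => ?_⟩
    exact isConvexProgram_supportFn_add_perspTerm hq hκ hA (hℓ.convexOn hC) _
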